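/- Let $V\subseteq\mathbb R^n$ be open and let $M$ be the superdomain with body $V$, even coordinates $x^1,\dots,x^n$ and odd coordinates $\xi^1,\dots,\xi^m$; thus $C^\infty(M)=C^\infty(V)\otimes\Lambda(\xi^1,\dots,\xi^m)$. ($M$ plays the role of a coordinate neighbourhood of a supermanifold.) Write $x^a$ for all coordinates, $\tilde a\in\mathbb Z_2$ for the parity of $x^a$, and $\tilde F$ for the parity of $F$. On $T^*M$, with conjugate momenta $p_a$ of parity $\tilde a$, the canonical Poisson bracket is $$(F,G)=\sum_a\Bigl((-1)^{\tilde a(\tilde F+1)}\frac{\partial F}{\partial p_a}\frac{\partial G}{\partial x^a}-(-1)^{\tilde a\tilde F}\frac{\partial F}{\partial x^a}\frac{\partial G}{\partial p_a}\Bigr)$$ with left derivatives. The algebra of densities $\mathfrak V(M)$ consists of the finite formal sums $\sum_w\psi_w(x)(Dx)^w$ over real weights $w$, with $\psi_w\in C^\infty(M)$; such a sum is identified with the function $\sum_w\psi_w(x)t^w$ on the extended manifold $\hat M$ with coordinates $x^a$ and $t>0$ ($t$ even). A long bracket of parity $\varepsilon$ and weight $\lambda\in\mathbb R$ is a bilinear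 operation $\{\psi;\chi\}$ on $\mathfrak V(M)$ of parity $\varepsilon$, taking densities of weights $w_1,w_2$ to a density of weight $w_1+w_2+\lambda$, with $\{a;b\}=(-1)^{\tilde a\tilde b}\{b;a\}$ and $\{a;bc\}=\{a;b\}c+(-1)^{(\tilde a+\varepsilon)\tilde b}b\{a;c\}$. Theorem. Let $\lambda\in\mathbb R$, let $S^{ab},\gamma^a,\theta\in C^\infty(M)$ have parities $1+\tilde a+\tilde b$, $1+\tilde a$ and $1$, and let $\{\psi;\chi\}$ be an odd long bracket of weight $\lambda$ specified by the master Hamiltonian $$\hat S=\tfrac12\,t^{\lambda}\bigl(S^{ab}p_bp_a+2t\gamma^ap_ap_t+t^2\theta p_t^2\bigr)$$ on $T^*\hat M$, i.e. $\{\psi;\chi\}=((\hat S,\psi),\chi)$ for the canonical Poisson bracket on $T^*\hat M$. Put $S=\frac12S^{ab}p_bp_a$ and $\gamma=\gamma^ap_a$ and regard $S,\gamma,\theta$ as functions on $T^*M$. Then the Jacobi identity $$(-1)^{\tilde a\tilde c}\{\{a;b\};c\}+(-1)^{\tilde c\tilde b}\{\{c;a\};b\}+(-1)^{\tilde b\tilde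 a}\{\{b;c\};a\}=0\quad\text{for all parity-homogeneous }a,b,c\in\mathfrak V(M)$$ holds if and only if the following equations hold on $T^*M$, where $(\cdot,\cdot)$ is the canonical Poisson bracket of $T^*M$: $$(S,S)=2\lambda S\gamma,\qquad (S,\gamma)=\lambda S\theta,\qquad (S,\theta)+(\gamma,\gamma)=\lambda\gamma\theta,\qquad (\gamma,\theta)=0.$$ -/

import Mathlib

open scoped TensorProduct ContDiff

noncomputable section

namespace SuperDensity

open TopologicalSpace

/-! ### Smooth functions on an open subset of a Euclidean space -/

section Smooth

variable {ι ι' : Type}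

/-- Extension by zero of a function on `V` to the ambient space (only its values near points of
the open set `V` are ever used). -/
def extendZero {V : Opens (ι → ℝ)} (f : V → ℝ) : (ι → ℝ) → ℝ :=
  Function.extend Subtype.val f 0

theorem extendZero_apply {V : Opens (ι → ℝ)} (f : V → ℝ) (x : V) :
    extendZero f (x : ι → ℝ) = f x :=
  Subtype.val_injective.extend_apply f 0 x

theorem extendZero_restrict_eqOn {V : Opens (ι → ℝ)} (F : (ι → ℝ) → ℝ) :
    Set.EqOn (extendZero fun x : V => F x) F V :=
  fun x hx => extendZero_apply (fun x : V => F x) ⟨x, hx⟩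

variable [Fintype ι] [Fintype ι']

/-- The algebra `C^∞(V)` of smooth real functions on the open set `V`. -/
def smoothFunctions (V : Opens (ι → ℝ)) : Subalgebra ℝ (V → ℝ) where
  carrier := {f | ContDiffOn ℝ ∞ (extendZero f) V}
  mul_mem' {f g} hf hg := (ContDiffOn.mul hf hg).congr fun x hx => by
    simp [extendZero_apply _ (⟨x, hx⟩ : V)]
  add_mem' {f g} hf hg := (ContDiffOn.add hf hg).congr fun x hx => by
    simp [extendZero_apply _ (⟨x, hx⟩ : V)]
  algebraMap_mem' r := (contDiffOn_const (c := r)).congr fun x hx => by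
    simp [extendZero_apply _ (⟨x, hx⟩ : V)]

/-- The restriction to `V` of a function that is smooth on `V`. -/
def restrictSmooth {V : Opens (ι → ℝ)} (F : (ι → ℝ) → ℝ) (hF : ContDiffOn ℝ ∞ F V) :
    smoothFunctions V :=
  ⟨fun x => F x, hF.congr (extendZero_restrict_eqOn F)⟩

theorem differentiableAt_extendZero {V : Opens (ι → ℝ)} (f : smoothFunctions V) (x : V) :
    DifferentiableAt ℝ (extendZero f.1) (x : ι → ℝ) :=
  (f.2.contDiffAt (V.isOpen.mem_nhds x.2)).differentiableAt (by simp)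

/-- The partial derivative `∂/∂x^i : C^∞(V) → C^∞(V)`. -/
def pderivSmooth [DecidableEq ι] {V : Opens (ι → ℝ)} (i : ι) :
    smoothFunctions V →ₗ[ℝ] smoothFunctions V where
  toFun f := restrictSmooth (fun x => fderiv ℝ (extendZero f.1) x (Pi.single i 1)) <|
    (f.2.fderiv_of_isOpen V.isOpen (m := ∞) (by simp)).clm_apply contDiffOn_const
  map_add' f g := by
    ext x
    have h : extendZero (f + g).1 =ᶠ[nhds (x : ι → ℝ)] extendZero f.1 + extendZero g.1 := by
      filter_upwards [V.isOpen.mem_nhds x.2] with y hy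
      simp [extendZero_apply _ (⟨y, hy⟩ : V)]
    change fderiv ℝ (extendZero (f + g).1) x (Pi.single i 1) =
      fderiv ℝ (extendZero f.1) x (Pi.single i 1) + fderiv ℝ (extendZero g.1) x (Pi.single i 1)
    rw [h.fderiv_eq, fderiv_add (differentiableAt_extendZero f x)
      (differentiableAt_extendZero g x)]
    rfl
  map_smul' c f := by
    ext x
    have h : extendZero (c • f).1 =ᶠ[nhds (x : ι → ℝ)] c • extendZero f.1 := by
      filter_upwards [V.isOpen.mem_nhds x.2] with y hy
      simp [extendZero_apply _ (⟨y, hy⟩ : V)]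
    change fderiv ℝ (extendZero (c • f).1) x (Pi.single i 1) =
      c • fderiv ℝ (extendZero f.1) x (Pi.single i 1)
    rw [h.fderiv_eq, fderiv_const_smul (differentiableAt_extendZero f x)]
    rfl

/-- Pull-back of smooth functions along the projection `z ↦ (z^{e(i)})_i`. -/
def pullSmooth {V : Opens (ι → ℝ)} {W : Opens (ι' → ℝ)} (e : ι → ι')
    (h : ∀ z ∈ W, z ∘ e ∈ V) : smoothFunctions V →ₐ[ℝ] smoothFunctions W where
  toFun f := ⟨fun z => f.1 ⟨z.1 ∘ e, h z.1 z.2⟩, by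
    have hp : ContDiff ℝ ∞ fun z : ι' → ℝ => z ∘ e := by
      rw [contDiff_pi]
      exact fun i => contDiff_apply ℝ ℝ (e i)
    refine (ContDiffOn.comp (s := (W : Set (ι' → ℝ))) f.2 hp.contDiffOn h).congr fun z hz => ?_
    rw [extendZero_apply _ (⟨z, hz⟩ : W)]
    exact (extendZero_apply f.1 ⟨z ∘ e, h z hz⟩).symm⟩
  map_one' := rfl
  map_mul' _ _ := rfl
  map_zero' := rfl
  map_add' _ _ := rfl
  commutes' _ := rfl

end Smooth

/-! ### Superdomains

The superdomain with body `V ⊆ ℝ^ι` and odd coordinates `ξ^k`, `k : κ`, has the algebra of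
functions `C^∞(V) ⊗ Λ(ξ^k)`.  Its coordinates are indexed by `ι ⊕ κ` (even ones on the left). -/

section Superdomain

variable {ι ι' κ κ' : Type} [Fintype ι] [Fintype ι']

/-- Functions on the superdomain with body `V` and odd coordinates indexed by `κ`. -/
abbrev SuperFun (V : Opens (ι → ℝ)) (κ : Type) : Type :=
  smoothFunctions V ⊗[ℝ] ExteriorAlgebra ℝ (κ →₀ ℝ)

instance (V : Opens (ι → ℝ)) (κ : Type) : Ring (SuperFun V κ) :=
  Algebra.TensorProduct.instRing

instance (V : Opens (ι → ℝ)) (κ : Type) : AddCommGroup (SuperFun V κ) :=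
  Ring.toAddCommGroup

/-- `sgn ε = (-1)^ε`. -/
def sgn (ε : ZMod 2) : ℝ := (-1) ^ ε.val

/-- The parity of the coordinate with a given index. -/
def coordParity : ι ⊕ κ → ZMod 2 := Sum.elim (fun _ => 0) (fun _ => 1)

/-- The parity automorphism, `f ↦ (-1)^ε f` on functions of parity `ε`. -/
def parityAut {V : Opens (ι → ℝ)} : SuperFun V κ →ₐ[ℝ] SuperFun V κ :=
  Algebra.TensorProduct.map (AlgHom.id ℝ _) CliffordAlgebra.involute

/-- `f` is homogeneous of parity `ε` (zero is homogeneous of both parities). -/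
def HasParity {V : Opens (ι → ℝ)} (ε : ZMod 2) (f : SuperFun V κ) : Prop :=
  parityAut f = sgn ε • f

/-- The linear operator acting on `f` of parity `δ` as multiplication by `(-1)^(ε δ)`. -/
def parityTwist {V : Opens (ι → ℝ)} (ε : ZMod 2) (f : SuperFun V κ) : SuperFun V κ :=
  if ε = 0 then f else parityAut f

/-- The coordinate functions. -/
def coord {V : Opens (ι → ℝ)} : ι ⊕ κ → SuperFun V κ :=
  Sum.elim
    (fun i => restrictSmooth (fun x => x i) (contDiff_apply ℝ ℝ i).contDiffOn ⊗ₜ[ℝ] 1)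
    (fun k => 1 ⊗ₜ[ℝ] ExteriorAlgebra.ι ℝ (Finsupp.single k 1))

/-- The (left) partial derivatives with respect to the coordinates: for an even coordinate it acts
on the coefficients, for an odd one it is the left antiderivation of the exterior algebra with
`∂ξ^l/∂ξ^k = δ_k^l`. -/
def pderiv [DecidableEq ι] {V : Opens (ι → ℝ)} : ι ⊕ κ → SuperFun V κ →ₗ[ℝ] SuperFun V κ :=
  Sum.elim
    (fun i => LinearMap.rTensor _ (pderivSmooth i))
    (fun k => LinearMap.lTensor _ (CliffordAlgebra.contractLeft (Finsupp.lapply k)))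

/-- Pull-back of functions along a projection of superdomains that forgets some coordinates: the
coordinate with index `i` (resp. `k`) is sent to the one with index `e i` (resp. `o k`). -/
def pullback {V : Opens (ι → ℝ)} {W : Opens (ι' → ℝ)} (e : ι → ι')
    (h : ∀ z ∈ W, z ∘ e ∈ V) (o : κ → κ') : SuperFun V κ →ₐ[ℝ] SuperFun W κ' :=
  Algebra.TensorProduct.map (pullSmooth e h) (ExteriorAlgebra.map (Finsupp.lmapDomain ℝ ℝ o))

end Superdomain

/-! ### The cotangent bundle and its canonical Poisson bracket

The cotangent bundle of a superdomain has coordinates `x^a` (summands `Sum.inl`) and conjugate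
momenta `p_a` (summands `Sum.inr`), `p_a` being of the same parity as `x^a`. -/

section Cotangent

variable {ι κ : Type} [Fintype ι]

/-- The body of the cotangent bundle, `V × ℝ^ι`. -/
def cotangent (V : Opens (ι → ℝ)) : Opens (ι ⊕ ι → ℝ) :=
  ⟨{z | z ∘ Sum.inl ∈ V}, V.isOpen.preimage (by fun_prop)⟩

/-- The index of `x^a` as a coordinate on the cotangent bundle. -/
def posIdx : ι ⊕ κ → (ι ⊕ ι) ⊕ (κ ⊕ κ) := Sum.map Sum.inl Sum.inl

/-- The index of `p_a` as a coordinate on the cotangent bundle. -/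
def momIdx : ι ⊕ κ → (ι ⊕ ι) ⊕ (κ ⊕ κ) := Sum.map Sum.inr Sum.inr

/-- Functions on a superdomain considered as functions on its cotangent bundle. -/
def toCotangent {V : Opens (ι → ℝ)} : SuperFun V κ →ₐ[ℝ] SuperFun (cotangent V) (κ ⊕ κ) :=
  pullback Sum.inl (fun _ hz => hz) Sum.inl

/-- The momentum `p_a` as a function on the cotangent bundle. -/
def momentum {V : Opens (ι → ℝ)} (a : ι ⊕ κ) : SuperFun (cotangent V) (κ ⊕ κ) :=
  coord (momIdx a)

/-- The canonical (even) Poisson bracket on the cotangent bundle,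
`(F,G) = ∑_a (-1)^{ã(F̃+1)} ∂F/∂p_a ∂G/∂x^a - (-1)^{ãF̃} ∂F/∂x^a ∂G/∂p_a`,
normalized by `(p_a, x^a) = 1`. -/
def poisson [Fintype κ] [DecidableEq ι] {V : Opens (ι → ℝ)}
    (F G : SuperFun (cotangent V) (κ ⊕ κ)) : SuperFun (cotangent V) (κ ⊕ κ) :=
  ∑ a : ι ⊕ κ,
    (sgn (coordParity a) •
        (pderiv (momIdx a) (parityTwist (coordParity a) F) * pderiv (posIdx a) G) -
      pderiv (posIdx a) (parityTwist (coordParity a) F) * pderiv (momIdx a) G)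

end Cotangent

/-! ### Densities

Densities of weight `w` on a superdomain have the form `ψ(x) (Dx)^w`.  The extended manifold has
the additional even coordinate `t > 0`, which stands for the coordinate volume element `Dx`; its
index is `Sum.inr ()`. -/

section Density

variable {ι κ : Type} [Fintype ι]

/-- The algebra of densities: finite formal sums `∑ ψ_w (Dx)^w` over real weights `w`, with
`(ψ (Dx)^v) (χ (Dx)^w) = ψ χ (Dx)^(v+w)`. -/
abbrev Density (V : Opens (ι → ℝ)) (κ : Type) : Type := AddMonoidAlgebra (SuperFun V κ) ℝ

/-- A density is homogeneous of parity `ε` if all of its coefficients are. -/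
def DensityHasParity {V : Opens (ι → ℝ)} (ε : ZMod 2) (ψ : Density V κ) : Prop :=
  ∀ w : ℝ, HasParity ε (ψ.coeff w)

/-- A density is homogeneous of weight `w` if it has the form `f (Dx)^w`. -/
def DensityHasWeight {V : Opens (ι → ℝ)} (w : ℝ) (ψ : Density V κ) : Prop :=
  ∃ f : SuperFun V κ, ψ = AddMonoidAlgebra.single w f

/-- The body of the extended manifold, `V × (0, ∞)`. -/
def extended (V : Opens (ι → ℝ)) : Opens (ι ⊕ Unit → ℝ) :=
  ⟨{z | z ∘ Sum.inl ∈ V ∧ 0 < z (Sum.inr ())},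
    (V.isOpen.preimage (f := fun z : ι ⊕ Unit → ℝ => z ∘ Sum.inl) (by fun_prop)).inter
      (isOpen_lt continuous_const (continuous_apply _))⟩

/-- Functions on the superdomain considered as functions on the extended manifold. -/
def toExtended {V : Opens (ι → ℝ)} : SuperFun V κ →ₐ[ℝ] SuperFun (extended V) κ :=
  pullback Sum.inl (fun _ hz => hz.1) id

/-- The function `t^w` on the extended manifold. -/
def tPow {V : Opens (ι → ℝ)} (w : ℝ) : SuperFun (extended V) κ :=
  restrictSmooth (fun z => z (Sum.inr ()) ^ w)
    ((contDiff_apply ℝ ℝ (Sum.inr ())).contDiffOn.rpow_const_of_ne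
      fun _ hz => (ne_of_gt hz.2)) ⊗ₜ[ℝ] 1

/-- The generating function `∑ ψ_w(x) t^w` of a density `∑ ψ_w (Dx)^w`. -/
def genFun {V : Opens (ι → ℝ)} (ψ : Density V κ) : SuperFun (extended V) κ :=
  ψ.coeff.sum fun w f => toExtended f * tPow w

end Density

/-! ### Long brackets -/

section LongBracket

variable {ι κ : Type} [Fintype ι]

/-- A long bracket of parity `ε` and weight `lam`: a bracket (symmetric bi-derivation) of parity `ε`
in the algebra of densities with `w({ψ;χ}) = w(ψ) + w(χ) + lam`. -/
structure LongBracket (V : Opens (ι → ℝ)) (κ : Type) (ε : ZMod 2) (lam : ℝ) where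
  /-- The operation `{ψ;χ}`. -/
  op : Density V κ →ₗ[ℝ] Density V κ →ₗ[ℝ] Density V κ
  parity : ∀ (α β : ZMod 2) (ψ χ : Density V κ), DensityHasParity α ψ → DensityHasParity β χ →
    DensityHasParity (α + β + ε) (op ψ χ)
  weight : ∀ (v w : ℝ) (ψ χ : Density V κ), DensityHasWeight v ψ → DensityHasWeight w χ →
    DensityHasWeight (v + w + lam) (op ψ χ)
  symm : ∀ (α β : ZMod 2) (ψ χ : Density V κ), DensityHasParity α ψ → DensityHasParity β χ →
    op ψ χ = sgn (α * β) • op χ ψ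
  leibniz : ∀ (α β : ZMod 2) (ψ χ φ : Density V κ), DensityHasParity α ψ →
    DensityHasParity β χ → op ψ (χ * φ) = op ψ χ * φ + sgn ((α + ε) * β) • (χ * op ψ φ)

/-- The Jacobi identity for an odd symmetric bracket:
`(-1)^{ãc̃} {{a;b};c} + (-1)^{c̃b̃} {{c;a};b} + (-1)^{b̃ã} {{b;c};a} = 0`. -/
def LongBracket.Jacobi {V : Opens (ι → ℝ)} {lam : ℝ} (B : LongBracket V κ 1 lam) : Prop :=
  ∀ (α β δ : ZMod 2) (a b c : Density V κ),
    DensityHasParity α a → DensityHasParity β b → DensityHasParity δ c →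
    sgn (α * δ) • B.op (B.op a b) c + sgn (δ * β) • B.op (B.op c a) b +
      sgn (β * α) • B.op (B.op b c) a = 0

/-- The coefficients `S^{ab}`, `γ^a`, `θ` of a master Hamiltonian of parity `ε`.  Only the graded
symmetric part of `S^{ab}` enters the Hamiltonians below. -/
structure BracketCoeffs (V : Opens (ι → ℝ)) (κ : Type) (ε : ZMod 2) where
  S : ι ⊕ κ → ι ⊕ κ → SuperFun V κ
  γ : ι ⊕ κ → SuperFun V κ
  θ : SuperFun V κ
  parity_S : ∀ a b, HasParity (ε + coordParity a + coordParity b) (S a b)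
  parity_γ : ∀ a, HasParity (ε + coordParity a) (γ a)
  parity_θ : HasParity ε θ

namespace BracketCoeffs

variable [Fintype κ] {V : Opens (ι → ℝ)} {ε : ZMod 2}

/-- `S = ½ S^{ab} p_b p_a` on the cotangent bundle of the superdomain. -/
def hamS (C : BracketCoeffs V κ ε) : SuperFun (cotangent V) (κ ⊕ κ) :=
  (1 / 2 : ℝ) • ∑ a, ∑ b, toCotangent (C.S a b) * momentum b * momentum a

/-- `γ = γ^a p_a` on the cotangent bundle of the superdomain. -/
def hamγ (C : BracketCoeffs V κ ε) : SuperFun (cotangent V) (κ ⊕ κ) :=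
  ∑ a, toCotangent (C.γ a) * momentum a

/-- `θ` as a function on the cotangent bundle of the superdomain. -/
def hamθ (C : BracketCoeffs V κ ε) : SuperFun (cotangent V) (κ ⊕ κ) :=
  toCotangent C.θ

/-- The master Hamiltonian on the cotangent bundle of the extended manifold,
`Ŝ = ½ t^lam (S^{ab} p_b p_a + 2 t γ^a p_a p_t + t² θ p_t²)`. -/
def master (C : BracketCoeffs V κ ε) (lam : ℝ) :
    SuperFun (cotangent (extended V)) (κ ⊕ κ) :=
  let f : SuperFun V κ → SuperFun (cotangent (extended V)) (κ ⊕ κ) :=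
    fun c => toCotangent (toExtended c)
  let p : ι ⊕ κ → SuperFun (cotangent (extended V)) (κ ⊕ κ) :=
    fun a => momentum (Sum.map Sum.inl id a)
  let t : SuperFun (cotangent (extended V)) (κ ⊕ κ) :=
    toCotangent (coord (Sum.inl (Sum.inr ())))
  let p_t : SuperFun (cotangent (extended V)) (κ ⊕ κ) :=
    momentum (Sum.inl (Sum.inr ()))
  (1 / 2 : ℝ) • (toCotangent (tPow lam) *
    ((∑ a, ∑ b, f (C.S a b) * p b * p a) + (2 : ℝ) • ∑ a, t * f (C.γ a) * p a * p_t
      + t ^ 2 * f C.θ * p_t ^ 2))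

end BracketCoeffs

/-- The long bracket `B` is specified by the function `H` on the cotangent bundle of the extended
manifold: `{ψ;χ} = ((H,ψ),χ)`. -/
def LongBracket.SpecifiedBy [Fintype κ] [DecidableEq ι] {V : Opens (ι → ℝ)} {ε : ZMod 2} {lam : ℝ}
    (B : LongBracket V κ ε lam) (H : SuperFun (cotangent (extended V)) (κ ⊕ κ)) : Prop :=
  ∀ ψ χ : Density V κ,
    toCotangent (genFun (B.op ψ χ)) =
      poisson (poisson H (toCotangent (genFun ψ))) (toCotangent (genFun χ))

end LongBracket

end SuperDensity

end

open TopologicalSpace SuperDensity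

noncomputable section

namespace SuperDensity

open TopologicalSpace

/-! ### Exterior algebras -/

section Exterior

variable {M N : Type*} [AddCommGroup M] [Module ℝ M] [AddCommGroup N] [Module ℝ N]

/-! The long bracket is a derived bracket, {ψ;χ} = ((Ŝ,ψ),χ), of the canonical even bracket on T*M̂,
and any two functions on M̂ Poisson-commute there. The graded Jacobi identity for Ŝ, Ŝ, a, b, c
therefore collapses twice the Jacobiator of a, b, c to ±((((Ŝ,Ŝ),a),b),c) (`Hom.jacobiator`). Hence
(Ŝ,Ŝ) = 0 implies the Jacobi identity, because a density is determined by its generating function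
(`genFun_injective`). Conversely, the coordinates x^a and t are themselves generating functions of
densities. Testing on them shows that all third momentum derivatives of (Ŝ,Ŝ) vanish, and (Ŝ,Ŝ) is
homogeneous of degree 2 + 2 - 1 = 3 in the momenta, so Euler's formula gives (Ŝ,Ŝ) = 0
(`eq_zero_of_poisson_coord_eq_zero`). Thus the Jacobi identity is equivalent to the master equation
(Ŝ,Ŝ) = 0.

To split the master equation into components, put τ = t p_t and write Ŝ = t^λ (S + τγ + ½τ²θ). Both
t^λ and τ commute with every function on T*M, while (τ, t^λ) = λ t^λ. As S, γ, θ are odd, their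
squares vanish, and (θ,θ) = 0. Expanding (`br_self_master`) gives (Ŝ,Ŝ) = t^{2λ} ( [(S,S) - 2λSγ] +
2τ[(S,γ) - λSθ] + τ²[(S,θ) + (γ,γ) - λγθ] + τ³(γ,θ) ). The factor t^{2λ} is invertible and the
bracketed coefficients do not depend on p_t, so differentiating along p_t forces each of them to
vanish (`eq_zero_of_polynomial_eq_zero`). These are the four equations.

The sign calculus is done once, in the abstract structure `CanonicalData`: a supercommutative
algebra with supercommuting superderivations. There the bracket with a homogeneous F is a vector
field, and the graded Jacobi identity follows from the supercommutator of vector fields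
(`Hom.jacobi`). -/

open CliffordAlgebra in
theorem involute_ι_exterior (v : M) :
    involute (ExteriorAlgebra.ι ℝ v) = -ExteriorAlgebra.ι ℝ v :=
  involute_ι v

theorem ι_mul_eq_involute_mul (v : M) (a : ExteriorAlgebra ℝ M) :
    ExteriorAlgebra.ι ℝ v * a = CliffordAlgebra.involute a * ExteriorAlgebra.ι ℝ v := by
  induction a using ExteriorAlgebra.induction with
  | algebraMap r => rw [AlgHom.commutes, Algebra.commutes]
  | ι x =>
    rw [involute_ι_exterior, neg_mul]
    exact eq_neg_of_add_eq_zero_left (ExteriorAlgebra.ι_add_mul_swap v x)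
  | mul a b ha hb => rw [← mul_assoc, ha, map_mul, mul_assoc, hb, mul_assoc]
  | add a b ha hb => rw [mul_add, ha, hb, map_add, add_mul]

theorem even_mul_comm_exterior {b : ExteriorAlgebra ℝ M}
    (hb : CliffordAlgebra.involute b = b) (a : ExteriorAlgebra ℝ M) : b * a = a * b := by
  induction a using ExteriorAlgebra.induction with
  | algebraMap r => rw [Algebra.commutes]
  | ι x => rw [ι_mul_eq_involute_mul, hb]
  | mul a c ha hc => rw [← mul_assoc, ha, mul_assoc, hc, mul_assoc]
  | add a c ha hc => rw [mul_add, ha, hc, add_mul]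

theorem odd_mul_comm_exterior {b : ExteriorAlgebra ℝ M}
    (hb : CliffordAlgebra.involute b = -b) (a : ExteriorAlgebra ℝ M) :
    b * a = CliffordAlgebra.involute a * b := by
  induction a using ExteriorAlgebra.induction with
  | algebraMap r => rw [AlgHom.commutes, Algebra.commutes]
  | ι x => rw [involute_ι_exterior, neg_mul, ι_mul_eq_involute_mul, hb, neg_mul, neg_neg]
  | mul a c ha hc => rw [← mul_assoc, ha, mul_assoc, hc, map_mul, mul_assoc]
  | add a c ha hc => rw [mul_add, ha, hc, map_add, add_mul]

/-- The elements b ± involute b are twice the even and odd parts of b: the first commutes with a,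
the second passes it at the cost of an involution. In this form supercommutativity needs no
homogeneity and is bilinear, so it extends to tensor products. -/
theorem two_smul_mul_exterior (a b : ExteriorAlgebra ℝ M) :
    (2 : ℝ) • (b * a) = a * (b + CliffordAlgebra.involute b) +
      CliffordAlgebra.involute a * (b - CliffordAlgebra.involute b) := by
  have h0 := even_mul_comm_exterior (b := b + CliffordAlgebra.involute b)
    (by rw [map_add, CliffordAlgebra.involute_involute, add_comm]) a
  have h1 := odd_mul_comm_exterior (b := b - CliffordAlgebra.involute b)
    (by rw [map_sub, CliffordAlgebra.involute_involute, neg_sub]) a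
  rw [← h0, ← h1, ← add_mul, two_smul]
  rw [← add_mul]
  congr 1
  abel

/-- The contraction rule for a single generator extends to products by induction on a. The element b
stays general because the product case applies the hypothesis on the first factor to a longer right
factor. -/
theorem contractLeft_mul_exterior (d : Module.Dual ℝ M) (a b : ExteriorAlgebra ℝ M) :
    CliffordAlgebra.contractLeft d (a * b) =
      CliffordAlgebra.contractLeft d a * b +
        CliffordAlgebra.involute a * CliffordAlgebra.contractLeft d b := by
  induction a using ExteriorAlgebra.induction generalizing b with
  | algebraMap r =>
    rw [CliffordAlgebra.contractLeft_algebraMap_mul, CliffordAlgebra.contractLeft_algebraMap,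
      AlgHom.commutes, zero_mul, zero_add]
  | ι x =>
    rw [involute_ι_exterior, ExteriorAlgebra.ι, CliffordAlgebra.contractLeft_ι_mul,
      CliffordAlgebra.contractLeft_ι, ← Algebra.smul_def, neg_mul, sub_eq_add_neg]
  | mul a c ha hc =>
    rw [mul_assoc, ha, hc, ha, map_mul]
    noncomm_ring
  | add a c ha hc =>
    rw [add_mul, map_add, ha, hc, map_add, map_add]
    noncomm_ring

theorem involute_contractLeft_exterior (d : Module.Dual ℝ M) (a : ExteriorAlgebra ℝ M) :
    CliffordAlgebra.involute (CliffordAlgebra.contractLeft d a) =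
      -CliffordAlgebra.contractLeft d (CliffordAlgebra.involute a) := by
  induction a using ExteriorAlgebra.induction with
  | algebraMap r =>
    rw [AlgHom.commutes, CliffordAlgebra.contractLeft_algebraMap, map_zero, neg_zero]
  | ι x =>
    rw [involute_ι_exterior, map_neg, neg_neg, ExteriorAlgebra.ι, CliffordAlgebra.contractLeft_ι,
      AlgHom.commutes]
  | mul a c ha hc =>
    rw [contractLeft_mul_exterior, map_add, map_mul, map_mul, map_mul, contractLeft_mul_exterior,
      ha, hc, CliffordAlgebra.involute_involute]
    noncomm_ring
  | add a c ha hc => rw [map_add, map_add, map_add, map_add, ha, hc, neg_add]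

theorem involute_map_exterior (f : M →ₗ[ℝ] N) (a : ExteriorAlgebra ℝ M) :
    CliffordAlgebra.involute (ExteriorAlgebra.map f a) =
      ExteriorAlgebra.map f (CliffordAlgebra.involute a) := by
  induction a using ExteriorAlgebra.induction with
  | algebraMap r => simp only [AlgHom.commutes]
  | ι x => rw [ExteriorAlgebra.map_apply_ι, involute_ι_exterior, involute_ι_exterior, map_neg,
      ExteriorAlgebra.map_apply_ι]
  | mul a c ha hc => simp only [map_mul, ha, hc]
  | add a c ha hc => simp only [map_add, ha, hc]

theorem contractLeft_map_exterior (f : M →ₗ[ℝ] N) (d : Module.Dual ℝ N)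
    (a : ExteriorAlgebra ℝ M) :
    CliffordAlgebra.contractLeft d (ExteriorAlgebra.map f a) =
      ExteriorAlgebra.map f (CliffordAlgebra.contractLeft (d ∘ₗ f) a) := by
  induction a using ExteriorAlgebra.induction with
  | algebraMap r =>
    rw [AlgHom.commutes, CliffordAlgebra.contractLeft_algebraMap,
      CliffordAlgebra.contractLeft_algebraMap, map_zero]
  | ι x =>
    rw [ExteriorAlgebra.map_apply_ι, ExteriorAlgebra.ι, ExteriorAlgebra.ι,
      CliffordAlgebra.contractLeft_ι, CliffordAlgebra.contractLeft_ι, AlgHom.commutes]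
    rfl
  | mul a c ha hc =>
    rw [map_mul, contractLeft_mul_exterior, contractLeft_mul_exterior, map_add, map_mul, map_mul,
      ha, hc, involute_map_exterior]
  | add a c ha hc => simp only [map_add, ha, hc]

end Exterior

/-! ### Partial derivatives of smooth functions -/

section Smooth

variable {ι ι' : Type} [Fintype ι] [Fintype ι']
  {V : Opens (ι → ℝ)} {W : Opens (ι' → ℝ)}

theorem pullSmooth_injective {e : ι → ι'} (h : ∀ z ∈ W, z ∘ e ∈ V)
    (hs : ∀ x ∈ V, ∃ z ∈ W, z ∘ e = x) :
    Function.Injective (pullSmooth (V := V) (W := W) e h) := fun f g hfg => by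
  ext x
  obtain ⟨z, hz, hzx⟩ := hs x.1 x.2
  have hx : x = ⟨z ∘ e, h z hz⟩ := Subtype.ext hzx.symm
  rw [hx]
  exact congrFun (congrArg Subtype.val hfg) ⟨z, hz⟩

variable [DecidableEq ι] [DecidableEq ι']

theorem pderivSmooth_apply (i : ι) (f : smoothFunctions V) (x : V) :
    (pderivSmooth i f).1 x = fderiv ℝ (extendZero f.1) x (Pi.single i 1) := rfl

/-- A derivative at a point of the open set V depends only on the germ there, so the extension by
zero may be replaced by any convenient representative. -/
theorem pderivSmooth_apply_of_eqOn (i : ι) (f : smoothFunctions V) {F : (ι → ℝ) → ℝ}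
    (h : ∀ x : V, f.1 x = F x) (x : V) :
    (pderivSmooth i f).1 x = fderiv ℝ F x (Pi.single i 1) := by
  rw [pderivSmooth_apply, Filter.EventuallyEq.fderiv_eq]
  filter_upwards [V.isOpen.mem_nhds x.2] with y hy
  rw [← h ⟨y, hy⟩]
  exact extendZero_apply f.1 ⟨y, hy⟩

theorem pderivSmooth_mul (i : ι) (f g : smoothFunctions V) :
    pderivSmooth i (f * g) = pderivSmooth i f * g + f * pderivSmooth i g := by
  ext x
  have h := pderivSmooth_apply_of_eqOn i (f * g) (F := extendZero f.1 * extendZero g.1)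
    (fun x => by simp [extendZero_apply]) x
  rw [fderiv_mul (differentiableAt_extendZero f x) (differentiableAt_extendZero g x)] at h
  rw [h]
  simp [pderivSmooth_apply, extendZero_apply]
  ring

theorem pderivSmooth_one (i : ι) : pderivSmooth i (1 : smoothFunctions V) = 0 := by
  ext x
  rw [pderivSmooth_apply_of_eqOn i 1 (F := fun _ => 1) (fun _ => rfl) x]
  simp

theorem pderivSmooth_comm (i j : ι) (f : smoothFunctions V) :
    pderivSmooth i (pderivSmooth j f) = pderivSmooth j (pderivSmooth i f) := by
  ext x
  have key : ∀ i j : ι, (pderivSmooth i (pderivSmooth j f)).1 x =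
      fderiv ℝ (fderiv ℝ (extendZero f.1)) x (Pi.single i 1) (Pi.single j 1) := fun i j => by
    rw [pderivSmooth_apply_of_eqOn i (pderivSmooth j f)
      (F := fun y => fderiv ℝ (extendZero f.1) y (Pi.single j 1)) (fun _ => rfl) x]
    have hd : DifferentiableAt ℝ (fderiv ℝ (extendZero f.1)) x :=
      ((f.2.contDiffAt (V.isOpen.mem_nhds x.2)).fderiv_right (m := 1)
        (by norm_cast)).differentiableAt (by simp)
    simp [fderiv_clm_apply hd (differentiableAt_const _)]
  rw [key, key]
  refine ((f.2.contDiffAt (V.isOpen.mem_nhds x.2)).isSymmSndFDerivAt ?_).eq _ _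
  rw [minSmoothness_of_isRCLikeNormedField]
  norm_cast

omit [DecidableEq ι] in
theorem pderivSmooth_pullSmooth (e : ι → ι') (h : ∀ z ∈ W, z ∘ e ∈ V)
    (f : smoothFunctions V) (j : ι') (z : W) :
    (pderivSmooth j (pullSmooth e h f)).1 z =
      fderiv ℝ (extendZero f.1) (z.1 ∘ e) ((Pi.single j 1 : ι' → ℝ) ∘ e) := by
  let L : (ι' → ℝ) →L[ℝ] (ι → ℝ) :=
    ContinuousLinearMap.pi fun i => ContinuousLinearMap.proj (e i)
  rw [pderivSmooth_apply_of_eqOn j (pullSmooth e h f) (F := extendZero f.1 ∘ L)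
    (fun z => (extendZero_apply f.1 ⟨z.1 ∘ e, h z.1 z.2⟩).symm) z]
  have hd : DifferentiableAt ℝ (extendZero f.1) (L z.1) :=
    differentiableAt_extendZero f ⟨z.1 ∘ e, h z.1 z.2⟩
  rw [fderiv_comp _ hd L.differentiableAt, L.fderiv]
  rfl

theorem pderivSmooth_pullSmooth_of_mem {e : ι → ι'} (he : Function.Injective e)
    (h : ∀ z ∈ W, z ∘ e ∈ V) (f : smoothFunctions V) (i : ι) :
    pderivSmooth (e i) (pullSmooth e h f) = pullSmooth e h (pderivSmooth i f) := by
  ext z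
  rw [pderivSmooth_pullSmooth]
  have : (Pi.single (e i) 1 : ι' → ℝ) ∘ e = Pi.single i 1 := by
    ext k
    simp [Pi.single_apply, he.eq_iff]
  rw [this]
  rfl

theorem pderivSmooth_pullSmooth_of_notMem {e : ι → ι'} (h : ∀ z ∈ W, z ∘ e ∈ V)
    (f : smoothFunctions V) {j : ι'} (hj : ∀ i, e i ≠ j) :
    pderivSmooth j (pullSmooth e h f) = 0 := by
  ext z
  rw [pderivSmooth_pullSmooth]
  have : (Pi.single j 1 : ι' → ℝ) ∘ e = 0 := by
    ext k
    simp [hj k]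
  rw [this, map_zero]
  rfl

theorem pderivSmooth_coord (i j : ι) :
    pderivSmooth j (restrictSmooth (V := V) (fun x => x i) (contDiff_apply ℝ ℝ i).contDiffOn) =
      if i = j then 1 else 0 := by
  ext x
  rw [pderivSmooth_apply_of_eqOn j _ (F := ContinuousLinearMap.proj (R := ℝ) i) (fun _ => rfl) x,
    ContinuousLinearMap.fderiv]
  by_cases hij : i = j <;> simp [hij]

end Smooth

/-! ### Signs -/

theorem sgn_add (a b : ZMod 2) : sgn (a + b) = sgn a * sgn b := by
  have h : ∀ a b : ZMod 2, (a + b).val % 2 = (a.val + b.val) % 2 := by decide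
  rw [sgn, sgn, sgn, ← pow_add, neg_one_pow_eq_pow_mod_two, h, ← neg_one_pow_eq_pow_mod_two]

@[simp] theorem sgn_zero : sgn 0 = 1 := by simp [sgn]

@[simp] theorem sgn_one : sgn 1 = -1 := by
  rw [sgn, ZMod.val_one, pow_one]

theorem sgn_mul_self (a : ZMod 2) : sgn a * sgn a = 1 := by
  rw [← sgn_add, CharTwo.add_self_eq_zero, sgn_zero]

/-! ### The algebra of functions on a superdomain -/

section Superdomain

variable {ι ι' κ κ' : Type} [Fintype ι] [Fintype ι'] {V : Opens (ι → ℝ)} {W : Opens (ι' → ℝ)}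

theorem parityAut_tmul (f : smoothFunctions V) (a : ExteriorAlgebra ℝ (κ →₀ ℝ)) :
    parityAut (f ⊗ₜ[ℝ] a : SuperFun V κ) = f ⊗ₜ[ℝ] CliffordAlgebra.involute a := rfl

theorem parityAut_parityAut (F : SuperFun V κ) : parityAut (parityAut F) = F := by
  induction F using TensorProduct.induction_on with
  | zero => simp only [map_zero]
  | tmul f a => rw [parityAut_tmul, parityAut_tmul, CliffordAlgebra.involute_involute]
  | add F G hF hG => rw [map_add, map_add, hF, hG]

theorem two_smul_mul_comm (F G : SuperFun V κ) :
    (2 : ℝ) • (G * F) = F * (G + parityAut G) + parityAut F * (G - parityAut G) := by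
  induction F using TensorProduct.induction_on with
  | zero => simp only [map_zero, mul_zero, zero_mul, smul_zero, add_zero]
  | add F F' hF hF' =>
    rw [mul_add, smul_add, hF, hF', map_add, add_mul, add_mul]
    abel
  | tmul f a =>
    induction G using TensorProduct.induction_on with
    | zero => simp only [map_zero, mul_zero, zero_mul, smul_zero, add_zero, sub_zero]
    | add G G' hG hG' =>
      rw [add_mul, smul_add, hG, hG', map_add]
      noncomm_ring
    | tmul g b =>
      rw [parityAut_tmul, parityAut_tmul, ← TensorProduct.tmul_add, ← TensorProduct.tmul_sub,
        Algebra.TensorProduct.tmul_mul_tmul, Algebra.TensorProduct.tmul_mul_tmul,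
        Algebra.TensorProduct.tmul_mul_tmul, ← TensorProduct.tmul_smul, two_smul_mul_exterior,
        TensorProduct.tmul_add, mul_comm f g]

theorem coord_inl (i : ι) : (coord (Sum.inl i) : SuperFun V κ) =
    restrictSmooth (fun x => x i) (contDiff_apply ℝ ℝ i).contDiffOn ⊗ₜ[ℝ] 1 := rfl

theorem coord_inr (k : κ) : (coord (Sum.inr k) : SuperFun V κ) =
    1 ⊗ₜ[ℝ] ExteriorAlgebra.ι ℝ (Finsupp.single k 1) := rfl

section Derivative

variable [DecidableEq ι] [DecidableEq ι']

theorem pderiv_inl_tmul (i : ι) (f : smoothFunctions V) (a : ExteriorAlgebra ℝ (κ →₀ ℝ)) :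
    pderiv (Sum.inl i) (f ⊗ₜ[ℝ] a : SuperFun V κ) = pderivSmooth i f ⊗ₜ[ℝ] a := rfl

theorem pderiv_inr_tmul (k : κ) (f : smoothFunctions V) (a : ExteriorAlgebra ℝ (κ →₀ ℝ)) :
    pderiv (Sum.inr k) (f ⊗ₜ[ℝ] a : SuperFun V κ) =
      f ⊗ₜ[ℝ] CliffordAlgebra.contractLeft (Finsupp.lapply k) a := rfl

theorem pderiv_mul (j : ι ⊕ κ) (F G : SuperFun V κ) :
    pderiv j (F * G) = pderiv j F * G + parityTwist (coordParity j) F * pderiv j G := by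
  induction F using TensorProduct.induction_on with
  | zero => simp only [map_zero, zero_mul, parityTwist, ite_self, add_zero]
  | add F F' hF hF' =>
    have : parityTwist (coordParity j) (F + F') =
        parityTwist (coordParity j) F + parityTwist (coordParity j) F' := by
      unfold parityTwist
      split_ifs <;> simp only [map_add]
    rw [add_mul, map_add, hF, hF', map_add, this, add_mul, add_mul]
    abel
  | tmul f a =>
    induction G using TensorProduct.induction_on with
    | zero => simp only [map_zero, mul_zero, add_zero]
    | add G G' hG hG' =>
      rw [mul_add, map_add, hG, hG', map_add, mul_add, mul_add]
      abel
    | tmul g b =>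
      rw [Algebra.TensorProduct.tmul_mul_tmul]
      rcases j with i | k
      · rw [pderiv_inl_tmul, pderiv_inl_tmul, pderiv_inl_tmul, pderivSmooth_mul,
          TensorProduct.add_tmul, parityTwist, if_pos (by rfl),
          Algebra.TensorProduct.tmul_mul_tmul, Algebra.TensorProduct.tmul_mul_tmul]
      · rw [pderiv_inr_tmul, pderiv_inr_tmul, pderiv_inr_tmul, contractLeft_mul_exterior,
          TensorProduct.tmul_add, parityTwist, if_neg (by exact one_ne_zero), parityAut_tmul,
          Algebra.TensorProduct.tmul_mul_tmul, Algebra.TensorProduct.tmul_mul_tmul]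

theorem parityAut_pderiv (j : ι ⊕ κ) (F : SuperFun V κ) :
    parityAut (pderiv j F) = sgn (coordParity j) • pderiv j (parityAut F) := by
  induction F using TensorProduct.induction_on with
  | zero => simp only [map_zero, smul_zero]
  | add F F' hF hF' => rw [map_add, map_add, hF, hF', map_add, map_add, smul_add]
  | tmul f a =>
    rcases j with i | k
    · rw [pderiv_inl_tmul, parityAut_tmul, parityAut_tmul, pderiv_inl_tmul]
      exact (one_smul _ _).symm.trans (by rw [coordParity, Sum.elim_inl, sgn_zero])
    · rw [pderiv_inr_tmul, parityAut_tmul, parityAut_tmul, pderiv_inr_tmul,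
        involute_contractLeft_exterior, TensorProduct.tmul_neg, coordParity, Sum.elim_inr,
        sgn_one, neg_one_smul]

theorem pderiv_comm (i j : ι ⊕ κ) (F : SuperFun V κ) :
    pderiv i (pderiv j F) =
      sgn (coordParity i * coordParity j) • pderiv j (pderiv i F) := by
  induction F using TensorProduct.induction_on with
  | zero => simp only [map_zero, smul_zero]
  | add F F' hF hF' => rw [map_add, map_add, hF, hF', map_add, map_add, smul_add]
  | tmul f a =>
    rcases i with i | i <;> rcases j with j | j <;>
      simp only [pderiv_inl_tmul, pderiv_inr_tmul, coordParity, Sum.elim_inl, Sum.elim_inr,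
        mul_zero, mul_one, sgn_zero, sgn_one, one_smul, neg_one_smul]
    · rw [pderivSmooth_comm]
    · rw [CliffordAlgebra.contractLeft_comm, TensorProduct.tmul_neg]

theorem pderiv_coord [DecidableEq κ] (i j : ι ⊕ κ) :
    pderiv j (coord i : SuperFun V κ) = if i = j then 1 else 0 := by
  rcases i with i | i <;> rcases j with j | j
  · rw [coord_inl, pderiv_inl_tmul, pderivSmooth_coord]
    by_cases h : i = j
    · rw [if_pos h, if_pos (congrArg _ h)]
      rfl
    · rw [if_neg h, if_neg (fun h' => h (Sum.inl.inj h')), TensorProduct.zero_tmul]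
  · rw [if_neg Sum.inl_ne_inr, coord_inl, pderiv_inr_tmul, CliffordAlgebra.contractLeft_one,
      TensorProduct.tmul_zero]
  · rw [if_neg Sum.inr_ne_inl, coord_inr, pderiv_inl_tmul, pderivSmooth_one,
      TensorProduct.zero_tmul]
  · rw [coord_inr, pderiv_inr_tmul, ExteriorAlgebra.ι, CliffordAlgebra.contractLeft_ι,
      Finsupp.lapply_apply, Finsupp.single_apply]
    by_cases h : i = j
    · rw [if_pos h, if_pos (congrArg _ h), map_one]
      rfl
    · rw [if_neg h, if_neg (fun h' => h (Sum.inr.inj h')), map_zero, TensorProduct.tmul_zero]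

theorem pderiv_pullback_of_mem {e : ι → ι'} (he : Function.Injective e)
    (h : ∀ z ∈ W, z ∘ e ∈ V) {o : κ → κ'} (ho : Function.Injective o) (j : ι ⊕ κ)
    (F : SuperFun V κ) :
    pderiv (Sum.map e o j) (pullback (W := W) e h o F) = pullback e h o (pderiv j F) := by
  induction F using TensorProduct.induction_on with
  | zero => simp only [map_zero]
  | add F F' hF hF' => rw [map_add, map_add, hF, hF', map_add, map_add]
  | tmul f a =>
    rcases j with i | k
    · change pderivSmooth (e i) (pullSmooth e h f) ⊗ₜ[ℝ] _ = _
      rw [pderivSmooth_pullSmooth_of_mem he]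
      rfl
    · change _ ⊗ₜ[ℝ] CliffordAlgebra.contractLeft (Finsupp.lapply (o k))
        (ExteriorAlgebra.map _ a) = _
      rw [contractLeft_map_exterior]
      have : Finsupp.lapply (o k) ∘ₗ Finsupp.lmapDomain ℝ ℝ o =
          (Finsupp.lapply k : (κ →₀ ℝ) →ₗ[ℝ] ℝ) := by
        ext l
        simp only [LinearMap.coe_comp, Function.comp_apply, Finsupp.lsingle_apply,
          Finsupp.lmapDomain_apply, Finsupp.mapDomain_single, Finsupp.lapply_apply]
        rw [← Finsupp.mapDomain_single, Finsupp.mapDomain_apply ho]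
      rw [this]
      rfl

theorem pderiv_pullback_of_notMem {e : ι → ι'} (h : ∀ z ∈ W, z ∘ e ∈ V) (o : κ → κ')
    {j : ι' ⊕ κ'} (hj : ∀ i, Sum.map e o i ≠ j) (F : SuperFun V κ) :
    pderiv j (pullback (W := W) e h o F) = 0 := by
  induction F using TensorProduct.induction_on with
  | zero => simp only [map_zero]
  | add F F' hF hF' => rw [map_add, map_add, hF, hF', add_zero]
  | tmul f a =>
    rcases j with i | k
    · change pderivSmooth i (pullSmooth e h f) ⊗ₜ[ℝ] _ = _
      rw [pderivSmooth_pullSmooth_of_notMem h f (fun l hl => hj (Sum.inl l) (congrArg _ hl)),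
        TensorProduct.zero_tmul]
    · change _ ⊗ₜ[ℝ] CliffordAlgebra.contractLeft (Finsupp.lapply k)
        (ExteriorAlgebra.map _ a) = _
      rw [contractLeft_map_exterior]
      have : Finsupp.lapply k ∘ₗ Finsupp.lmapDomain ℝ ℝ o =
          (0 : (κ →₀ ℝ) →ₗ[ℝ] ℝ) := by
        ext l
        simp only [LinearMap.coe_comp, Function.comp_apply, Finsupp.lsingle_apply,
          Finsupp.lmapDomain_apply, Finsupp.mapDomain_single, Finsupp.lapply_apply]
        exact Finsupp.single_eq_of_ne fun hl => hj (Sum.inr l) (congrArg _ hl.symm)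
      rw [this, map_zero, LinearMap.zero_apply, map_zero, TensorProduct.tmul_zero]

end Derivative

theorem parityAut_coord (j : ι ⊕ κ) :
    parityAut (coord j : SuperFun V κ) = sgn (coordParity j) • coord j := by
  rcases j with i | k
  · rw [coordParity, Sum.elim_inl, sgn_zero, one_smul]
    change _ ⊗ₜ[ℝ] CliffordAlgebra.involute (1 : ExteriorAlgebra ℝ (κ →₀ ℝ)) = _
    rw [map_one]
    rfl
  · rw [coordParity, Sum.elim_inr, sgn_one, neg_one_smul]
    change _ ⊗ₜ[ℝ] CliffordAlgebra.involute (ExteriorAlgebra.ι ℝ (Finsupp.single k 1)) = _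
    rw [involute_ι_exterior, TensorProduct.tmul_neg]
    rfl

theorem parityAut_pullback (e : ι → ι') (h : ∀ z ∈ W, z ∘ e ∈ V) (o : κ → κ')
    (F : SuperFun V κ) :
    parityAut (pullback (W := W) e h o F) = pullback e h o (parityAut F) := by
  induction F using TensorProduct.induction_on with
  | zero => simp only [map_zero]
  | add F F' hF hF' => rw [map_add, map_add, hF, hF', map_add, map_add]
  | tmul f a =>
    change _ ⊗ₜ[ℝ] CliffordAlgebra.involute (ExteriorAlgebra.map _ a) = _
    rw [involute_map_exterior]
    rfl

theorem pullback_coord (e : ι → ι') (h : ∀ z ∈ W, z ∘ e ∈ V) (o : κ → κ') (j : ι ⊕ κ) :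
    pullback (W := W) e h o (coord j) = coord (Sum.map e o j) := by
  rcases j with i | k
  · change _ ⊗ₜ[ℝ] ExteriorAlgebra.map _ (1 : ExteriorAlgebra ℝ (κ →₀ ℝ)) = _
    rw [map_one]
    rfl
  · change (1 : smoothFunctions W) ⊗ₜ[ℝ]
      ExteriorAlgebra.map _ (ExteriorAlgebra.ι ℝ (Finsupp.single k 1)) = _
    rw [ExteriorAlgebra.map_apply_ι, Finsupp.lmapDomain_apply, Finsupp.mapDomain_single]
    rfl

/-- The body part is injective because the projection of bodies is onto, the exterior part because
it comes from an injective linear map over a field. Flatness over ℝ makes their tensor product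
injective. -/
theorem pullback_injective {e : ι → ι'} (h : ∀ z ∈ W, z ∘ e ∈ V) {o : κ → κ'}
    (hs : ∀ x ∈ V, ∃ z ∈ W, z ∘ e = x) (ho : Function.Injective o) :
    Function.Injective (pullback (V := V) (W := W) e h o) := by
  have h2 : Function.Injective (ExteriorAlgebra.map (Finsupp.lmapDomain ℝ ℝ o)) := by
    refine ExteriorAlgebra.map_injective_field ?_
    rw [LinearMap.ker_eq_bot]
    exact Finsupp.mapDomain_injective ho
  exact TensorProduct.map_injective_of_flat_flat (pullSmooth e h).toLinearMap
    (ExteriorAlgebra.map (Finsupp.lmapDomain ℝ ℝ o)).toLinearMap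
    (pullSmooth_injective h hs) h2

theorem pullback_pullback_comm {ι₁ ι₂ κ₁ κ₂ : Type} [Fintype ι₁] [Fintype ι₂]
    {U : Opens (ι₁ → ℝ)} {W' : Opens (ι₂ → ℝ)}
    {e : ι → ι'} {h : ∀ z ∈ W, z ∘ e ∈ V} {o : κ → κ'}
    {e' : ι' → ι₁} {h' : ∀ z ∈ U, z ∘ e' ∈ W} {o' : κ' → κ₁}
    {d : ι → ι₂} {k : ∀ z ∈ W', z ∘ d ∈ V} {p : κ → κ₂}
    {d' : ι₂ → ι₁} {k' : ∀ z ∈ U, z ∘ d' ∈ W'} {p' : κ₂ → κ₁}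
    (he : e' ∘ e = d' ∘ d) (ho : o' ∘ o = p' ∘ p) (F : SuperFun V κ) :
    pullback (W := U) e' h' o' (pullback e h o F) = pullback d' k' p' (pullback d k p F) := by
  induction F using TensorProduct.induction_on with
  | zero => simp only [map_zero]
  | add F F' hF hF' => simp only [map_add, hF, hF']
  | tmul f a =>
    change pullSmooth e' h' (pullSmooth e h f) ⊗ₜ[ℝ]
        ExteriorAlgebra.map (Finsupp.lmapDomain ℝ ℝ o')
          (ExteriorAlgebra.map (Finsupp.lmapDomain ℝ ℝ o) a) =
      pullSmooth d' k' (pullSmooth d k f) ⊗ₜ[ℝ]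
        ExteriorAlgebra.map (Finsupp.lmapDomain ℝ ℝ p')
          (ExteriorAlgebra.map (Finsupp.lmapDomain ℝ ℝ p) a)
    rw [← AlgHom.comp_apply (ExteriorAlgebra.map _), ← AlgHom.comp_apply (ExteriorAlgebra.map _),
      ExteriorAlgebra.map_comp_map, ExteriorAlgebra.map_comp_map, ← Finsupp.lmapDomain_comp, ← Finsupp.lmapDomain_comp, ho]
    congr 1
    ext z
    exact congrArg f.1 (Subtype.ext (congrArg (z.1 ∘ ·) he))

end Superdomain

/-! ### Poisson brackets of supercommuting derivations -/

/-- A supercommutative algebra with supercommuting superderivations `D j`, paired by an involution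
`conj` of the index set, and with the signs `σ j` of a canonical even Poisson bracket. -/
structure CanonicalData (A J : Type*) [Ring A] [Algebra ℝ A] where
  P : A →ₐ[ℝ] A
  P_P : ∀ F, P (P F) = F
  two_smul_mul : ∀ F G, (2 : ℝ) • (G * F) = F * (G + P G) + P F * (G - P G)
  par : J → ZMod 2
  D : J → A →ₗ[ℝ] A
  P_D : ∀ j F, P (D j F) = sgn (par j) • D j (P F)
  D_mul : ∀ j F G, D j (F * G) = D j F * G + (if par j = 0 then F else P F) * D j G
  D_comm : ∀ i j F, D i (D j F) = sgn (par i * par j) • D j (D i F)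
  conj : J → J
  conj_conj : ∀ j, conj (conj j) = j
  par_conj : ∀ j, par (conj j) = par j
  σ : J → ℝ
  σ_conj : ∀ j, σ (conj j) = -(sgn (par j) * σ j)

namespace CanonicalData

variable {A J : Type*} [Ring A] [Algebra ℝ A] (R : CanonicalData A J)

/-- Homogeneity with respect to the parity automorphism. -/
def Hom (ε : ZMod 2) (F : A) : Prop := R.P F = sgn ε • F

/-- Multiplication by `(-1)^(ε δ)` on elements of parity `δ`. -/
def tw (ε : ZMod 2) : A →ₗ[ℝ] A := if ε = 0 then LinearMap.id else R.P.toLinearMap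

variable {R} {f g k : ZMod 2} {F G K : A}

theorem eq_zero_or_eq_one (e : ZMod 2) : e = 0 ∨ e = 1 := by
  revert e
  decide

theorem tw_eq (e : ZMod 2) (F : A) : R.tw e F = if e = 0 then F else R.P F := by
  unfold tw
  split_ifs <;> rfl

theorem Hom.tw (hF : R.Hom f F) (e : ZMod 2) : R.tw e F = sgn (e * f) • F := by
  rw [tw_eq]
  rcases eq_zero_or_eq_one e with rfl | rfl
  · rw [if_pos rfl, zero_mul, sgn_zero, one_smul]
  · rw [if_neg one_ne_zero, one_mul]
    exact hF

theorem Hom.mul (hF : R.Hom f F) (hG : R.Hom g G) : R.Hom (f + g) (F * G) := by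
  unfold Hom at *
  rw [map_mul, hF, hG, sgn_add, smul_mul_smul_comm]

theorem Hom.add (hF : R.Hom f F) (hG : R.Hom f G) : R.Hom f (F + G) := by
  unfold Hom at *
  rw [map_add, hF, hG, smul_add]

theorem Hom.smul (c : ℝ) (hF : R.Hom f F) : R.Hom f (c • F) := by
  unfold Hom at *
  rw [map_smul, hF, smul_comm]

theorem Hom.sum {I : Type*} {s : Finset I} {F : I → A} (h : ∀ i ∈ s, R.Hom f (F i)) :
    R.Hom f (∑ i ∈ s, F i) := by
  unfold Hom at *
  rw [map_sum, Finset.smul_sum]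
  exact Finset.sum_congr rfl h

theorem Hom.D (hF : R.Hom f F) (j : J) : R.Hom (f + R.par j) (R.D j F) := by
  unfold Hom at *
  rw [R.P_D, hF, map_smul, smul_smul, sgn_add, mul_comm]

theorem Hom.mul_comm (hF : R.Hom f F) (hG : R.Hom g G) : G * F = sgn (f * g) • (F * G) := by
  have h := R.two_smul_mul F G
  have h2 : (2 : ℝ) • (G * F) = (2 : ℝ) • (sgn (f * g) • (F * G)) := by
    unfold Hom at *
    rw [h, hF, hG]
    rcases eq_zero_or_eq_one g with rfl | rfl
    · simp only [mul_zero, sgn_zero, one_smul, sub_self, add_zero, two_smul, mul_add]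
    · simp only [mul_one, sgn_one, neg_one_smul, sub_neg_eq_add, add_neg_cancel, mul_zero,
        zero_add, two_smul, mul_add, smul_mul_assoc]
  exact smul_right_injective A (two_ne_zero (α := ℝ)) h2

theorem Hom.commute (hF : R.Hom 0 F) (G : A) : F * G = G * F := by
  have h := R.two_smul_mul G F
  unfold Hom at hF
  rw [hF, sgn_zero, one_smul, sub_self, mul_zero, add_zero, mul_add, ← two_smul ℝ] at h
  exact smul_right_injective A (two_ne_zero (α := ℝ)) h

theorem Hom.D_mul (hF : R.Hom f F) (j : J) (G : A) :
    R.D j (F * G) = R.D j F * G + sgn (R.par j * f) • (F * R.D j G) := by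
  rw [R.D_mul, ← tw_eq, hF.tw, smul_mul_assoc]

theorem Hom.mul_self_eq_zero (hF : R.Hom 1 F) : F * F = 0 := by
  have h := hF.mul_comm hF
  rw [mul_one, sgn_one, neg_one_smul] at h
  have h2 : (2 : ℝ) • (F * F) = (2 : ℝ) • 0 := by
    rw [two_smul, smul_zero]
    exact eq_neg_iff_add_eq_zero.mp h
  exact smul_right_injective A (two_ne_zero (α := ℝ)) h2

variable [Fintype J] (R)

/-- The vector field `∑ X_j D_j`. -/
def vf (X : J → A) : A →ₗ[ℝ] A := ∑ j, LinearMap.mulLeft ℝ (X j) ∘ₗ R.D j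

/-- The canonical bracket. -/
def br : A →ₗ[ℝ] A →ₗ[ℝ] A :=
  ∑ j, R.σ j • (LinearMap.mul ℝ A).compl₁₂ (R.D (R.conj j) ∘ₗ R.tw (R.par j)) (R.D j)

theorem vf_apply (X : J → A) (F : A) : R.vf X F = ∑ j, X j * R.D j F := by
  simp [vf]

theorem br_apply (F G : A) :
    R.br F G = ∑ j, R.σ j • (R.D (R.conj j) (R.tw (R.par j) F) * R.D j G) := by
  simp [br]

variable {R}

theorem sgn_smul_congr {a b : ZMod 2} (h : a = b) (F : A) : sgn a • F = sgn b • F := by rw [h]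

theorem Hom.br_eq_sum (hF : R.Hom f F) (G : A) :
    R.br F G = ∑ j, (R.σ j * sgn (R.par j * f)) • (R.D (R.conj j) F * R.D j G) := by
  rw [br_apply]
  refine Finset.sum_congr rfl fun j _ => ?_
  rw [hF.tw, map_smul, smul_mul_assoc, smul_smul]

/-- The Hamiltonian vector field of F. It reduces the Jacobi identity to a supercommutator of vector
fields. -/
theorem Hom.br_eq_vf (hF : R.Hom f F) :
    R.br F = R.vf fun j => (R.σ j * sgn (R.par j * f)) • R.D (R.conj j) F := by
  ext G
  rw [hF.br_eq_sum, vf_apply]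
  simp only [smul_mul_assoc]

theorem Hom.br (hF : R.Hom f F) (hG : R.Hom g G) : R.Hom (f + g) (R.br F G) := by
  rw [hF.br_eq_sum]
  refine Hom.sum fun j _ => Hom.smul _ ?_
  have h := (hF.D (R.conj j)).mul (hG.D j)
  rw [R.par_conj] at h
  have e : f + R.par j + (g + R.par j) = f + g := 
    (by decide : ∀ f g j : ZMod 2, f + j + (g + j) = f + g) _ _ _
  rwa [e] at h

/-- Reindexing by `conj` exchanges the two differentiated factors, and `σ_conj` is the sign
condition under which the result is minus the supercommuted term. -/
theorem Hom.br_antisymm (hF : R.Hom f F) (hG : R.Hom g G) :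
    R.br G F = -(sgn (f * g) • R.br F G) := by
  rw [hF.br_eq_sum, hG.br_eq_sum, ← Equiv.sum_comp (Function.Involutive.toPerm R.conj R.conj_conj),
    Finset.smul_sum, ← Finset.sum_neg_distrib]
  refine Finset.sum_congr rfl fun j _ => ?_
  have hc := (hF.D (R.conj j)).mul_comm (hG.D j)
  rw [R.par_conj] at hc
  change (R.σ (R.conj j) * sgn (R.par (R.conj j) * g)) •
    (R.D (R.conj (R.conj j)) G * R.D (R.conj j) F) = _
  rw [R.conj_conj, R.par_conj, R.σ_conj]
  rw [hc, smul_smul, smul_smul, ← neg_smul]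
  congr 1
  -- Since `sgn` is additive to multiplicative, a sign identity is an identity of exponents in `ZMod
  -- 2`, which is a finite check (it uses j * j = j).
  have e : sgn (R.par j) * sgn (R.par j * g) * sgn ((f + R.par j) * (g + R.par j)) =
      sgn (f * g) * sgn (R.par j * f) := by
    simp only [← sgn_add]
    congr 1
    exact (by decide : ∀ f g j : ZMod 2, j + j * g + (f + j) * (g + j) = f * g + j * f) _ _ _
  linear_combination (-R.σ j) * e

theorem Hom.br_mul_right (hF : R.Hom f F) (hG : R.Hom g G) (K : A) :
    R.br F (G * K) = R.br F G * K + sgn (f * g) • (G * R.br F K) := by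
  rw [hF.br_eq_sum, hF.br_eq_sum, hF.br_eq_sum, Finset.sum_mul, Finset.mul_sum, Finset.smul_sum,
    ← Finset.sum_add_distrib]
  refine Finset.sum_congr rfl fun j _ => ?_
  have hc := hG.mul_comm (hF.D (R.conj j))
  rw [R.par_conj] at hc
  rw [hG.D_mul, mul_add, smul_add, smul_mul_assoc, mul_assoc, mul_smul_comm,
    ← mul_assoc _ G, hc, smul_mul_assoc, smul_smul, smul_smul, mul_smul_comm, smul_smul, mul_assoc G]
  congr 2
  have e : sgn (R.par j * g) * sgn (g * (f + R.par j)) = sgn (f * g) := by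
    simp only [← sgn_add]
    congr 1
    exact (by decide : ∀ f g j : ZMod 2, j * g + g * (f + j) = f * g) _ _ _
  linear_combination (R.σ j * sgn (R.par j * f)) * e

theorem Hom.br_mul_left (hF : R.Hom f F) (hG : R.Hom g G) (hK : R.Hom k K) :
    R.br (F * G) K = F * R.br G K + sgn (g * k) • (R.br F K * G) := by
  have h1 := hK.br_mul_right hF G
  rw [hK.br_antisymm (hF.mul hG), h1, hK.br_antisymm hF, hK.br_antisymm hG]
  rcases eq_zero_or_eq_one f with rfl | rfl <;> rcases eq_zero_or_eq_one g with rfl | rfl <;>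
  rcases eq_zero_or_eq_one k with rfl | rfl <;>
  simp [CharTwo.add_self_eq_zero, add_comm]

/-- The coefficients of the canonical bracket are constants, so a coordinate derivative meets only
the two arguments and supercommutes with the derivatives already applied to them. -/
theorem Hom.D_br (hF : R.Hom f F) (G : A) (i : J) :
    R.D i (R.br F G) = R.br (R.D i F) G + sgn (R.par i * f) • R.br F (R.D i G) := by
  rw [hF.br_eq_sum, (hF.D i).br_eq_sum, hF.br_eq_sum, map_sum, Finset.smul_sum,
    ← Finset.sum_add_distrib]
  refine Finset.sum_congr rfl fun j _ => ?_
  rw [map_smul, (hF.D (R.conj j)).D_mul, R.D_comm i (R.conj j), R.D_comm i j, R.par_conj,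
    smul_add, smul_mul_assoc, mul_smul_comm, smul_smul, smul_smul, smul_smul, smul_smul]
  congr 2
  · have e : sgn (R.par j * f) * sgn (R.par i * R.par j) = sgn (R.par j * (f + R.par i)) := by
      simp only [← sgn_add]
      congr 1
      ring
    linear_combination (R.σ j) * e
  · have e : sgn (R.par i * (f + R.par j)) * sgn (R.par i * R.par j) = sgn (R.par i * f) := by
      simp only [← sgn_add]
      congr 1
      exact (by decide : ∀ f i j : ZMod 2, i * (f + j) + i * j = i * f) _ _ _
    linear_combination (R.σ j * sgn (R.par j * f)) * e

/-- The supercommutator of vector fields is a vector field. -/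
theorem vf_vf_sub {X Y : J → A} (hX : ∀ j, R.Hom (f + R.par j) (X j))
    (hY : ∀ j, R.Hom (g + R.par j) (Y j)) (K : A) :
    R.vf X (R.vf Y K) - sgn (f * g) • R.vf Y (R.vf X K) =
      R.vf (fun j => R.vf X (Y j) - sgn (f * g) • R.vf Y (X j)) K := by
  -- A composite of two vector fields is split into its first-order part and its second-order part.
  have key : ∀ {X Y : J → A} {g : ZMod 2}, (∀ j, R.Hom (g + R.par j) (Y j)) →
      R.vf X (R.vf Y K) = R.vf (fun j => R.vf X (Y j)) K +
        ∑ j, ∑ l, sgn (R.par j * (g + R.par l)) • (X j * Y l * R.D j (R.D l K)) := by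
    intro X Y g hY
    simp only [vf_apply, map_sum, Finset.sum_mul]
    rw [Finset.sum_comm (f := fun j l => sgn (R.par j * (g + R.par l)) •
      (X j * Y l * R.D j (R.D l K))), ← Finset.sum_add_distrib]
    refine Finset.sum_congr rfl fun j _ => ?_
    rw [← Finset.sum_add_distrib]
    refine Finset.sum_congr rfl fun l _ => ?_
    rw [(hY j).D_mul, mul_add, mul_smul_comm, mul_assoc, mul_assoc]
  rw [key hY, key hX]
  -- The second-order parts of the two composites agree up to the sign of the supercommutator,
  -- because both the coefficients and the `D j` supercommute. They cancel in the difference.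
  have e : ∑ j, ∑ l, sgn (R.par j * (g + R.par l)) • (X j * Y l * R.D j (R.D l K)) =
      sgn (f * g) •
        ∑ j, ∑ l, sgn (R.par j * (f + R.par l)) • (Y j * X l * R.D j (R.D l K)) := by
    rw [Finset.sum_comm, Finset.smul_sum]
    refine Finset.sum_congr rfl fun l _ => ?_
    rw [Finset.smul_sum]
    refine Finset.sum_congr rfl fun j _ => ?_
    rw [(hX j).mul_comm (hY l), R.D_comm l j, mul_smul_comm, smul_mul_assoc, smul_smul, smul_smul,
      smul_smul]
    simp only [← sgn_add]
    refine sgn_smul_congr ?_ _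
    exact (by decide : ∀ f g j l : ZMod 2,
      j * (g + l) = f * g + l * (f + j) + l * j + (f + j) * (g + l)) _ _ _ _
  rw [e]
  simp only [vf_apply, sub_mul, Finset.sum_sub_distrib, smul_add, Finset.smul_sum, smul_mul_assoc,
    Finset.sum_mul]
  abel

/-- Both sides are vector fields applied to K, so it suffices to compare their coefficients. There
the identity is `Hom.D_br` followed by antisymmetry. -/
theorem Hom.jacobi (hF : R.Hom f F) (hG : R.Hom g G) (K : A) :
    R.br F (R.br G K) - sgn (f * g) • R.br G (R.br F K) = R.br (R.br F G) K := by
  have hX : ∀ {f : ZMod 2} {F : A}, R.Hom f F → ∀ j, R.Hom (f + R.par j)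
      ((R.σ j * sgn (R.par j * f)) • R.D (R.conj j) F) := fun hF j => by
    have := hF.D (R.conj j)
    rw [R.par_conj] at this
    exact this.smul _
  rw [(hF.br hG).br_eq_vf]
  have h := vf_vf_sub (hX hF) (hX hG) K
  rw [← hF.br_eq_vf, ← hG.br_eq_vf] at h
  rw [h]
  congr 2
  ext j
  rw [map_smul, map_smul, hF.D_br, (hF.D (R.conj j)).br_antisymm hG, R.par_conj,
    smul_add, smul_smul, smul_smul, smul_neg, sub_neg_eq_add, smul_smul, add_comm]
  congr 2
  · have e : sgn (f * g) * sgn (R.par j * f) * sgn ((f + R.par j) * g) =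
        sgn (R.par j * (f + g)) := by
      simp only [← sgn_add]
      congr 1
      exact (by decide : ∀ f g j : ZMod 2, f * g + j * f + (f + j) * g = j * (f + g)) _ _ _
    linear_combination (R.σ j) * e
  · have e : sgn (R.par j * g) = sgn (R.par j * (f + g)) * sgn (R.par j * f) := by
      simp only [← sgn_add]
      congr 1
      exact (by decide : ∀ f g j : ZMod 2, j * g = j * (f + g) + j * f) _ _ _
    linear_combination (R.σ j) * e

end CanonicalData

/-! ### Twisted commutation and criteria for vanishing brackets -/

namespace CanonicalData

variable {A J : Type*} [Ring A] [Algebra ℝ A] {R : CanonicalData A J}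
  {f g k : ZMod 2} {F G K : A}

theorem Hom.mul_eq_tw_mul (hF : R.Hom f F) (G : A) : F * G = R.tw f G * F := by
  rw [tw_eq]
  rcases eq_zero_or_eq_one f with rfl | rfl
  · rw [if_pos rfl, hF.commute]
  · rw [if_neg one_ne_zero]
    have h := R.two_smul_mul G F
    unfold Hom at hF
    rw [hF, sgn_one, neg_one_smul, add_neg_cancel, mul_zero, zero_add, sub_neg_eq_add, mul_add,
      ← two_smul ℝ] at h
    exact smul_right_injective A (two_ne_zero (α := ℝ)) h

theorem tw_tw (e : ZMod 2) (F : A) : R.tw e (R.tw e F) = F := by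
  rw [tw_eq, tw_eq]
  split_ifs
  · rfl
  · exact R.P_P F

theorem D_tw_eq_zero {j : J} (h : R.D j F = 0) (e : ZMod 2) : R.D j (R.tw e F) = 0 := by
  rw [tw_eq]
  split_ifs
  · exact h
  · have h2 := R.P_D j F
    rw [h, map_zero] at h2
    have h3 := congrArg (sgn (R.par j) • ·) h2
    simpa only [smul_smul, sgn_mul_self, one_smul, smul_zero] using h3.symm

variable [Fintype J]

theorem br_eq_zero (h : ∀ j, R.D (R.conj j) F = 0 ∨ R.D j G = 0) : R.br F G = 0 := by
  rw [br_apply]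
  refine Finset.sum_eq_zero fun j _ => ?_
  rcases h j with h | h
  · rw [D_tw_eq_zero h, zero_mul, smul_zero]
  · rw [h, mul_zero, smul_zero]

theorem br_of_D_eq_ite [DecidableEq J] {i : J} (h : ∀ j, R.D j G = if i = j then K else 0)
    (F : A) : R.br F G = R.σ i • (R.D (R.conj i) (R.tw (R.par i) F) * K) := by
  rw [br_apply, Finset.sum_eq_single i]
  · rw [h, if_pos rfl]
  · intro j _ hj
    rw [h, if_neg hj.symm, mul_zero, smul_zero]
  · exact fun hi => absurd (Finset.mem_univ i) hi

/-! #### The derived bracket and its Jacobiator -/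

/-- The Jacobi identity for H, F, G with the term (H, (F, G)) removed. -/
theorem Hom.derived_symm {H : A} (hH : R.Hom 1 H) (hF : R.Hom f F) (hG : R.Hom g G)
    (h : R.br F G = 0) : R.br (R.br H F) G = sgn (f * g) • R.br (R.br H G) F := by
  have hj := hH.jacobi hF G
  rw [h, map_zero, zero_sub, (hH.br hG).br_antisymm hF] at hj
  rw [← hj, smul_neg, neg_neg, smul_smul, ← sgn_add]
  exact sgn_smul_congr ((by decide : ∀ f g : ZMod 2, 1 * f + (1 + g) * f = f * g) _ _) _

/-- As H is odd, ((H,H),F) = 2(H,(H,F)). Pushing G and then K inside by the Jacobi identity produces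
the three nested derived brackets. The commutation hypotheses, which hold for functions pulled back
from the base, put their arguments in the required order. -/
theorem Hom.jacobiator {H : A} (hH : R.Hom 1 H) (hF : R.Hom f F) (hG : R.Hom g G)
    (hK : R.Hom k K) (hFK : R.br F K = 0) (h1 : R.br F (R.br (R.br H G) K) = 0)
    (h2 : R.br G (R.br (R.br H F) K) = 0) :
    (2 : ℝ) • (sgn (f * k) • R.br (R.br H (R.br (R.br H F) G)) K +
      sgn (k * g) • R.br (R.br H (R.br (R.br H K) F)) G +
      sgn (g * f) • R.br (R.br H (R.br (R.br H G) K)) F) =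
    sgn (f * k) • R.br (R.br (R.br (R.br H H) F) G) K := by
  have e1 : R.br (R.br H H) F = (2 : ℝ) • R.br H (R.br H F) := by
    rw [← hH.jacobi hH, mul_one, sgn_one, neg_one_smul, sub_neg_eq_add, two_smul]
  have hHF := hH.br hF
  have hHG := hH.br hG
  have hHK := hH.br hK
  have e2 := hH.jacobi hHF G
  have e3 := hHF.jacobi hHG K
  have s1 := hH.derived_symm hF (hHG.br hK) h1
  have s2 := hH.derived_symm hG (hHF.br hK) h2
  have s3 := hH.derived_symm hF hK hFK
  rw [e1, map_smul, LinearMap.smul_apply, map_smul, LinearMap.smul_apply, ← e2, map_sub, map_smul,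
    LinearMap.sub_apply, LinearMap.smul_apply, ← e3, s1, s2, s3, map_smul, map_smul,
    LinearMap.smul_apply]
  rcases eq_zero_or_eq_one f with rfl | rfl <;> rcases eq_zero_or_eq_one g with rfl | rfl <;>
  rcases eq_zero_or_eq_one k with rfl | rfl <;>
  simp only [CharTwo.add_self_eq_zero, add_zero, zero_add, mul_zero, mul_one,
    sgn_zero, sgn_one, one_smul, neg_one_smul] <;> module

/-! #### Euler vector fields -/

/-- When `X j` has the parity of `D j`, the vector field is even and satisfies the Leibniz rule
without signs. -/
theorem vf_mul {X : J → A} (hX : ∀ j, R.Hom (R.par j) (X j)) (F G : A) :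
    R.vf X (F * G) = R.vf X F * G + F * R.vf X G := by
  rw [vf_apply, vf_apply, vf_apply, Finset.sum_mul, Finset.mul_sum, ← Finset.sum_add_distrib]
  refine Finset.sum_congr rfl fun j _ => ?_
  rw [R.D_mul, ← tw_eq, mul_add, ← mul_assoc, ← mul_assoc, (hX j).mul_eq_tw_mul (R.tw _ F), tw_tw,
    mul_assoc F]

/-- For a field linear in the coordinates with weights w, the commutator with `D i` is -w i times `D
i`: differentiation along i lowers the weight by w i. -/
theorem vf_D {X : J → A} (hX : ∀ j, R.Hom (R.par j) (X j)) [DecidableEq J] {w : J → ℝ}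
    (hw : ∀ i j, R.D i (X j) = if i = j then algebraMap ℝ A (w j) else 0) (i : J) (F : A) :
    R.vf X (R.D i F) = R.D i (R.vf X F) - w i • R.D i F := by
  have e : R.D i (R.vf X F) = ∑ j, R.D i (X j) * R.D j F + R.vf X (R.D i F) := by
    rw [vf_apply, vf_apply, map_sum, ← Finset.sum_add_distrib]
    refine Finset.sum_congr rfl fun j _ => ?_
    rw [(hX j).D_mul, R.D_comm i j, mul_smul_comm, smul_smul, sgn_mul_self, one_smul]
  rw [e, Finset.sum_eq_single i, hw, if_pos rfl, ← Algebra.smul_def, add_sub_cancel_left]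
  · intro j _ hj
    rw [hw, if_neg hj.symm, zero_mul]
  · exact fun hi => absurd (Finset.mem_univ i) hi

/-- Each term of the bracket differentiates once along j and once along `conj j`, so it loses total
weight w j + w (conj j) = 1. -/
theorem Hom.vf_br {X : J → A} (hX : ∀ j, R.Hom (R.par j) (X j)) [DecidableEq J] {w : J → ℝ}
    (hw : ∀ i j, R.D i (X j) = if i = j then algebraMap ℝ A (w j) else 0)
    (hw1 : ∀ j, w j + w (R.conj j) = 1) {d e : ℝ} (hF : R.Hom f F) (hd : R.vf X F = d • F)
    (he : R.vf X G = e • G) : R.vf X (R.br F G) = (d + e - 1) • R.br F G := by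
  rw [hF.br_eq_sum, map_sum, Finset.smul_sum]
  refine Finset.sum_congr rfl fun j _ => ?_
  have hj : w (R.conj j) = 1 - w j := eq_sub_of_add_eq' (hw1 j)
  rw [map_smul, vf_mul hX, vf_D hX hw, vf_D hX hw, hd, he, map_smul, map_smul, hj, ← sub_smul,
    ← sub_smul, smul_mul_assoc, mul_smul_comm]
  module

/-! #### Brackets of sums of products -/

theorem Hom.br_mul_mul {u v : A} (hF : R.Hom 0 F) (hG : R.Hom 0 G) (hu : R.Hom 1 u)
    (hv : R.Hom 1 v) (h1 : R.br u G = 0) (h2 : R.br F v = 0) :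
    R.br (F * u) (G * v) = F * (G * R.br u v) + R.br F G * (u * v) := by
  have hGv : R.Hom 1 (G * v) := by simpa using hG.mul hv
  rw [hF.br_mul_left hu hGv, hu.br_mul_right hG, hF.br_mul_right hG, h1, h2]
  simp only [zero_mul, mul_zero, smul_zero, add_zero, zero_add, mul_one, sgn_zero, one_smul,
    sgn_one, neg_one_smul, mul_assoc, hu.mul_comm hv, mul_neg, neg_neg]

theorem Hom.br_self_even (hF : R.Hom 0 F) : R.br F F = 0 := by
  have h := hF.br_antisymm hF
  rw [mul_zero, sgn_zero, one_smul] at h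
  have h2 : (2 : ℝ) • R.br F F = (2 : ℝ) • 0 := by
    rw [two_smul, smul_zero]
    exact eq_neg_iff_add_eq_zero.mp h
  exact smul_right_injective A (two_ne_zero (α := ℝ)) h2

theorem Hom.br_comm_odd (hF : R.Hom 1 F) (hG : R.Hom 1 G) : R.br G F = R.br F G := by
  rw [hF.br_antisymm hG, mul_one, sgn_one, neg_one_smul, neg_neg]

/-- Applied with T = t^λ, τ = t p_t and u₀, u₁, u₂ = S, γ, θ. All terms with λ come from the bracket
of T with τ. The squares of the odd uᵢ vanish, so only the mixed products u₀u₁, u₀u₂, u₁u₂ acquire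
such corrections. -/
theorem br_self_master {T τ u₀ u₁ u₂ : A} {lam : ℝ} (hT : R.Hom 0 T) (hτ : R.Hom 0 τ)
    (h₀ : R.Hom 1 u₀) (h₁ : R.Hom 1 u₁) (h₂ : R.Hom 1 u₂)
    (hT₀ : R.br T u₀ = 0) (hT₁ : R.br T u₁ = 0) (hT₂ : R.br T u₂ = 0)
    (hτ₀ : R.br τ u₀ = 0) (hτ₁ : R.br τ u₁ = 0) (hτ₂ : R.br τ u₂ = 0)
    (hτT : R.br τ T = lam • T) (h₂₂ : R.br u₂ u₂ = 0) :
    R.br (T * (u₀ + τ * u₁ + (1 / 2 : ℝ) • (τ * (τ * u₂))))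
        (T * (u₀ + τ * u₁ + (1 / 2 : ℝ) • (τ * (τ * u₂)))) =
      T * (T * ((R.br u₀ u₀ - (2 * lam) • (u₀ * u₁)) +
        τ * ((2 : ℝ) • (R.br u₀ u₁ - lam • (u₀ * u₂))) +
        τ * (τ * (R.br u₀ u₂ + R.br u₁ u₁ - lam • (u₁ * u₂))) +
        τ * (τ * (τ * R.br u₁ u₂)))) := by
  have hc : τ * T = T * τ := hτ.commute T
  have hc' : ∀ x, τ * (T * x) = T * (τ * x) := fun x => by rw [← mul_assoc, hc, mul_assoc]
  have hTτ : R.Hom 0 (T * τ) := hT.mul hτ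
  have hTττ : R.Hom 0 (T * (τ * τ)) := hT.mul (hτ.mul hτ)
  have z : ∀ {F u : A}, R.Hom 0 F → R.Hom 1 u → R.br F u = 0 → R.br u F = 0 :=
    fun hF hu h => by rw [hF.br_antisymm hu, h, smul_zero, neg_zero]
  have zl : ∀ {F G u : A}, R.Hom 0 F → R.Hom 0 G → R.Hom 1 u → R.br F u = 0 → R.br G u = 0 →
      R.br (F * G) u = 0 := fun hF hG hu h h' => by
    rw [hF.br_mul_left hG hu, h, h']
    simp only [mul_zero, zero_mul, smul_zero, add_zero]
  have hTT := hT.br_self_even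
  have hττ := hτ.br_self_even
  have hTbτ : R.br T τ = -(lam • T) := by
    rw [hτ.br_antisymm hT, hτT, mul_zero, sgn_zero, one_smul]
  have b01 : R.br T (T * τ) = -(lam • (T * T)) := by
    rw [hT.br_mul_right hT, hTT, hTbτ, zero_mul, zero_add, mul_zero, sgn_zero, one_smul, mul_neg,
      mul_smul_comm]
  have bτ : R.br T (τ * τ) = -((2 * lam) • (T * τ)) := by
    rw [hT.br_mul_right hτ, hTbτ, mul_zero, sgn_zero, one_smul, mul_neg, neg_mul, smul_mul_assoc,
      mul_smul_comm, hc]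
    module
  have b02 : R.br T (T * (τ * τ)) = -((2 * lam) • (T * (T * τ))) := by
    rw [hT.br_mul_right hT, hTT, bτ, zero_mul, zero_add, mul_zero, sgn_zero, one_smul, mul_neg,
      mul_smul_comm]
  have bτ2 : R.br τ (T * (τ * τ)) = lam • (T * (τ * τ)) := by
    rw [hτ.br_mul_right hT, hτ.br_mul_right hτ, hττ, hτT, smul_mul_assoc]
    simp only [zero_mul, mul_zero, smul_zero, add_zero]
  have b12 : R.br (T * τ) (T * (τ * τ)) = -(lam • (T * (T * (τ * τ)))) := by
    rw [hT.br_mul_left hτ hTττ, bτ2, b02, mul_zero, sgn_zero, one_smul, mul_smul_comm, neg_mul,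
      smul_mul_assoc, mul_assoc, mul_assoc]
    module
  -- Each summand is regrouped as an even factor in T and τ times an odd uᵢ, the shape required by
  -- `Hom.br_mul_mul`.
  have e : T * (u₀ + τ * u₁ + (1 / 2 : ℝ) • (τ * (τ * u₂))) =
      T * u₀ + (T * τ) * u₁ + (1 / 2 : ℝ) • ((T * (τ * τ)) * u₂) := by
    rw [mul_add, mul_add, mul_smul_comm]
    simp only [mul_assoc]
  have o₀ : R.Hom 1 (T * u₀) := by simpa using hT.mul h₀
  have o₁ : R.Hom 1 ((T * τ) * u₁) := by simpa using hTτ.mul h₁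
  have o₂ : R.Hom 1 ((T * (τ * τ)) * u₂) := by simpa using hTττ.mul h₂
  have q1 : ∀ {u}, R.Hom 1 u → R.br T u = 0 → R.br τ u = 0 → R.br (T * τ) u = 0 :=
    fun hu h h' => zl hT hτ hu h h'
  have q2 : ∀ {u}, R.Hom 1 u → R.br T u = 0 → R.br τ u = 0 → R.br (T * (τ * τ)) u = 0 :=
    fun hu h h' => zl hT (hτ.mul hτ) hu h (zl hτ hτ hu h' h')
  rw [e]
  simp only [map_add, map_smul, LinearMap.add_apply, LinearMap.smul_apply]
  rw [o₀.br_comm_odd o₁, o₀.br_comm_odd o₂, o₁.br_comm_odd o₂,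
    hT.br_mul_mul hT h₀ h₀ (z hT h₀ hT₀) hT₀,
    hT.br_mul_mul hTτ h₀ h₁ (z hTτ h₀ (q1 h₀ hT₀ hτ₀)) hT₁,
    hT.br_mul_mul hTττ h₀ h₂ (z hTττ h₀ (q2 h₀ hT₀ hτ₀)) hT₂,
    hTτ.br_mul_mul hTτ h₁ h₁ (z hTτ h₁ (q1 h₁ hT₁ hτ₁)) (q1 h₁ hT₁ hτ₁),
    hTτ.br_mul_mul hTττ h₁ h₂ (z hTττ h₁ (q2 h₁ hT₁ hτ₁)) (q1 h₂ hT₂ hτ₂),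
    hTττ.br_mul_mul hTττ h₂ h₂ (z hTττ h₂ (q2 h₂ hT₂ hτ₂)) (q2 h₂ hT₂ hτ₂),
    Hom.mul_self_eq_zero h₀, Hom.mul_self_eq_zero h₁, Hom.mul_self_eq_zero h₂, h₂₂, b01, b02, b12]
  simp only [mul_zero, add_zero, mul_add, mul_sub, mul_assoc, hc', neg_mul, smul_mul_assoc,
    mul_smul_comm]
  module

/-- The Bᵢ are constants for D and D τ = t is invertible, so each application of D lowers the degree
in τ by one. Three applications isolate B₃, and back-substitution gives the rest. In the application
D is the derivative along p_t. -/
theorem eq_zero_of_polynomial_eq_zero {D : A →ₗ[ℝ] A}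
    (hD : ∀ F G, D (F * G) = D F * G + F * D G) {t t' τ : A}
    (ht : ∀ x, t * x = x * t) (ht' : t' * t = 1) (hτ : D τ = t)
    {B₀ B₁ B₂ B₃ : A} (h₀ : D B₀ = 0) (h₁ : D B₁ = 0) (h₂ : D B₂ = 0) (h₃ : D B₃ = 0)
    (h : B₀ + τ * B₁ + τ * (τ * B₂) + τ * (τ * (τ * B₃)) = 0) :
    B₀ = 0 ∧ B₁ = 0 ∧ B₂ = 0 ∧ B₃ = 0 := by
  have hc : ∀ x, τ * (t * x) = t * (τ * x) := fun x => by rw [← mul_assoc, ← ht, mul_assoc]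
  have cancel : ∀ {x}, t * x = 0 → x = 0 := fun {x} hx => by
    rw [← one_mul x, ← ht', mul_assoc, hx, mul_zero]
  have d1 : B₁ + (2 : ℝ) • (τ * B₂) + (3 : ℝ) • (τ * (τ * B₃)) = 0 := by
    refine cancel ?_
    have := congrArg D h
    simp only [map_add, hD, hτ, h₀, h₁, h₂, h₃, map_zero, mul_zero, add_zero, zero_add, mul_add,
      hc] at this
    simp only [mul_add, mul_smul_comm]
    rw [← this]
    module
  have d2 : B₂ + (3 : ℝ) • (τ * B₃) = 0 := by
    refine cancel ?_
    have := congrArg D d1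
    simp only [map_add, map_smul, hD, hτ, h₁, h₂, h₃, map_zero, mul_zero, add_zero, zero_add,
      hc] at this
    have h2 := congrArg ((1 / 2 : ℝ) • ·) this
    simp only [smul_zero] at h2
    simp only [mul_add, mul_smul_comm]
    rw [← h2]
    module
  have d3 : B₃ = 0 := by
    refine cancel ?_
    have := congrArg D d2
    simp only [map_add, map_smul, hD, hτ, h₂, h₃, map_zero, mul_zero, add_zero, zero_add] at this
    exact (smul_eq_zero.mp this).resolve_left three_ne_zero
  subst d3
  simp only [mul_zero, smul_zero, add_zero] at d2
  subst d2
  simp only [mul_zero, smul_zero, add_zero] at d1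
  subst d1
  simp only [mul_zero, add_zero] at h
  exact ⟨h, rfl, rfl, rfl⟩

end CanonicalData

open CanonicalData

/-! ### The canonical bracket on a cotangent bundle -/

section CotangentIndex

variable {ι κ : Type}

theorem coordParity_posIdx (a : ι ⊕ κ) : coordParity (posIdx a) = coordParity a := by
  rcases a with a | a <;> rfl

theorem coordParity_momIdx (a : ι ⊕ κ) : coordParity (momIdx a) = coordParity a := by
  rcases a with a | a <;> rfl

/-- The index of `x^a` or `p_a` as a coordinate on the cotangent bundle. -/
def cotangentIdx : (ι ⊕ κ) ⊕ (ι ⊕ κ) → (ι ⊕ ι) ⊕ (κ ⊕ κ) := Sum.elim posIdx momIdx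

theorem cotangentIdx_injective : Function.Injective (cotangentIdx (ι := ι) (κ := κ)) := by
  rintro ((a | a) | (a | a)) ((b | b) | (b | b)) h <;>
    simp_all [cotangentIdx, posIdx, momIdx]

end CotangentIndex

section Cotangent

variable {ι : Type} [Fintype ι] (V : Opens (ι → ℝ)) (κ : Type)

variable {V κ} in
theorem toCotangent_coord (a : ι ⊕ κ) :
    toCotangent (coord a : SuperFun V κ) = coord (posIdx a) := pullback_coord _ _ _ a

variable {V κ} in
theorem toCotangent_injective :
    Function.Injective (toCotangent : SuperFun V κ → SuperFun (cotangent V) (κ ⊕ κ)) :=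
  pullback_injective _ (fun x hx => ⟨Sum.elim x 0, hx, rfl⟩) Sum.inl_injective

variable [DecidableEq ι]

/-- The canonical coordinates on the cotangent bundle. -/
def canonicalData :
    CanonicalData (SuperFun (cotangent V) (κ ⊕ κ)) ((ι ⊕ κ) ⊕ (ι ⊕ κ)) where
  P := parityAut
  P_P := parityAut_parityAut
  two_smul_mul := two_smul_mul_comm
  par j := coordParity (cotangentIdx j)
  D j := pderiv (cotangentIdx j)
  P_D j := parityAut_pderiv _
  D_mul j := pderiv_mul _
  D_comm i j := pderiv_comm _ _
  conj := Sum.swap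
  conj_conj := Sum.swap_swap
  par_conj j := by rcases j with (a | a) | (a | a) <;> rfl
  σ := Sum.elim (fun a => sgn (coordParity a)) (fun _ => -1)
  σ_conj j := by
    rcases j with a | a
    · change -1 = -(sgn (coordParity (posIdx a)) * sgn (coordParity a))
      rw [coordParity_posIdx, sgn_mul_self]
    · change sgn (coordParity a) = -(sgn (coordParity (momIdx a)) * -1)
      rw [coordParity_momIdx, mul_neg_one, neg_neg]

variable {V κ}

theorem poisson_eq_br [Fintype κ] (F G : SuperFun (cotangent V) (κ ⊕ κ)) :
    poisson F G = (canonicalData V κ).br F G := by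
  rw [br_apply, Fintype.sum_sum_type, ← Finset.sum_add_distrib]
  refine Finset.sum_congr rfl fun a _ => ?_
  rw [tw_eq, tw_eq, sub_eq_add_neg, ← neg_one_smul ℝ (pderiv (posIdx a) _ * _)]
  change _ = sgn (coordParity a) • (pderiv (momIdx a)
    (if coordParity (posIdx a) = 0 then F else parityAut F) * pderiv (posIdx a) G) +
    (-1 : ℝ) • (pderiv (posIdx a) (if coordParity (momIdx a) = 0 then F else parityAut F) *
      pderiv (momIdx a) G)
  rw [coordParity_posIdx, coordParity_momIdx]
  rfl

theorem pderiv_momIdx_toCotangent (a : ι ⊕ κ) (F : SuperFun V κ) :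
    pderiv (momIdx a) (toCotangent F) = 0 := by
  refine pderiv_pullback_of_notMem _ _ ?_ F
  rcases a with a | a <;> rintro (b | b) h <;> simp [momIdx] at h

theorem pderiv_posIdx_toCotangent (a : ι ⊕ κ) (F : SuperFun V κ) :
    pderiv (posIdx a) (toCotangent F) = toCotangent (pderiv a F) :=
  pderiv_pullback_of_mem Sum.inl_injective _ Sum.inl_injective a F

theorem HasParity.hom {ε : ZMod 2} {F : SuperFun V κ} (h : HasParity ε F) :
    (canonicalData V κ).Hom ε (toCotangent F) := by
  refine (parityAut_pullback _ _ _ F).trans ?_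
  rw [h, map_smul]
  rfl

theorem momentum_hom (a : ι ⊕ κ) : (canonicalData V κ).Hom (coordParity a) (momentum a) := by
  have h := parityAut_coord (V := cotangent V) (momIdx a)
  rwa [coordParity_momIdx] at h

/-! ### Homogeneity in the momenta -/

section

variable (V κ) in
/-- The components of the Euler vector field `∑ p_a ∂/∂p_a`. -/
def eulerField : (ι ⊕ κ) ⊕ (ι ⊕ κ) → SuperFun (cotangent V) (κ ⊕ κ) :=
  Sum.elim (fun _ => 0) momentum

theorem eulerField_hom (j : (ι ⊕ κ) ⊕ (ι ⊕ κ)) :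
    (canonicalData V κ).Hom ((canonicalData V κ).par j) (eulerField V κ j) := by
  rcases j with a | a
  · change parityAut 0 = _ • (0 : SuperFun (cotangent V) (κ ⊕ κ))
    rw [map_zero, smul_zero]
  · change (canonicalData V κ).Hom (coordParity (momIdx a)) (momentum a)
    rw [coordParity_momIdx]
    exact momentum_hom a

variable [Fintype κ]

variable (V κ) in
/-- The Euler vector field `∑ p_a ∂/∂p_a` on the cotangent bundle. -/
abbrev euler : SuperFun (cotangent V) (κ ⊕ κ) →ₗ[ℝ] SuperFun (cotangent V) (κ ⊕ κ) :=
  (canonicalData V κ).vf (eulerField V κ)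

theorem euler_apply (F : SuperFun (cotangent V) (κ ⊕ κ)) :
    euler V κ F = ∑ a, momentum a * pderiv (momIdx a) F := by
  rw [euler, vf_apply, Fintype.sum_sum_type, Finset.sum_eq_zero, zero_add]
  · rfl
  · exact fun a _ => zero_mul _

theorem euler_mul {d e : ℝ} {F G : SuperFun (cotangent V) (κ ⊕ κ)} (hF : euler V κ F = d • F)
    (hG : euler V κ G = e • G) : euler V κ (F * G) = (d + e) • (F * G) := by
  rw [vf_mul eulerField_hom, hF, hG, smul_mul_assoc, mul_smul_comm, add_smul]

theorem euler_toCotangent (F : SuperFun V κ) :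
    euler V κ (toCotangent F) = (0 : ℝ) • toCotangent F := by
  rw [euler_apply, zero_smul]
  exact Finset.sum_eq_zero fun a _ => by rw [pderiv_momIdx_toCotangent, mul_zero]

/-- Euler's formula recovers a function of nonzero degree d from its momentum derivatives. -/
theorem eq_zero_of_pderiv_momIdx_eq_zero {d : ℝ} (hd : d ≠ 0)
    {F : SuperFun (cotangent V) (κ ⊕ κ)} (hF : euler V κ F = d • F)
    (h : ∀ a, pderiv (momIdx a) F = 0) : F = 0 := by
  rw [euler_apply, Finset.sum_eq_zero fun a _ => by rw [h, mul_zero]] at hF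
  exact (smul_eq_zero.mp hF.symm).resolve_left hd

variable [DecidableEq κ]

omit [Fintype κ] in
theorem pderiv_momIdx_momentum (a b : ι ⊕ κ) :
    pderiv (momIdx b) (momentum a : SuperFun (cotangent V) (κ ⊕ κ)) = if a = b then 1 else 0 := by
  refine (pderiv_coord _ _).trans ?_
  have h : momIdx a = momIdx b ↔ a = b :=
    (cotangentIdx_injective.eq_iff (a := Sum.inr a) (b := Sum.inr b)).trans Sum.inr_injective.eq_iff
  simp only [h]

omit [Fintype κ] in
theorem D_coord (i j : (ι ⊕ κ) ⊕ (ι ⊕ κ)) :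
    (canonicalData V κ).D j (coord (cotangentIdx i)) = if i = j then 1 else 0 := by
  change pderiv (cotangentIdx j) _ = _
  rw [pderiv_coord]
  simp only [cotangentIdx_injective.eq_iff]

omit [Fintype κ] in
theorem D_eulerField (i j : (ι ⊕ κ) ⊕ (ι ⊕ κ)) :
    (canonicalData V κ).D i (eulerField V κ j) =
      if i = j then algebraMap ℝ _ (Sum.elim (fun _ => 0) (fun _ => 1) j) else 0 := by
  rcases j with a | a
  · simp [eulerField]
  · rw [Sum.elim_inr, map_one]
    simp only [eq_comm (a := i)]
    exact D_coord (Sum.inr a) i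

theorem euler_momentum (a : ι ⊕ κ) :
    euler V κ (momentum a) = (1 : ℝ) • momentum a := by
  rw [euler_apply, one_smul, Finset.sum_eq_single a]
  · rw [pderiv_momIdx_momentum, if_pos rfl, mul_one]
  · intro b _ hb
    rw [pderiv_momIdx_momentum, if_neg hb.symm, mul_zero]
  · exact fun h => absurd (Finset.mem_univ a) h

theorem euler_poisson {f : ZMod 2} {d e : ℝ} {F G : SuperFun (cotangent V) (κ ⊕ κ)}
    (hf : (canonicalData V κ).Hom f F) (hF : euler V κ F = d • F) (hG : euler V κ G = e • G) :
    euler V κ (poisson F G) = (d + e - 1) • poisson F G := by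
  rw [poisson_eq_br]
  -- Positions have weight 0 and momenta weight 1, so conjugate weights add up to 1.
  exact hf.vf_br eulerField_hom D_eulerField (by rintro (a | a) <;> simp [canonicalData]) hF hG

/-- The bracket with a coordinate function is a derivative along the momentum, up to sign. -/
theorem poisson_coord {f : ZMod 2} {F : SuperFun (cotangent V) (κ ⊕ κ)}
    (hF : (canonicalData V κ).Hom f F) (a : ι ⊕ κ) :
    poisson F (toCotangent (coord a)) =
      (sgn (coordParity a) * sgn (coordParity a * f)) • pderiv (momIdx a) F := by
  have h := br_of_D_eq_ite (R := canonicalData V κ) (i := Sum.inl a) (G := coord (posIdx a))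
    (K := 1) (D_coord (Sum.inl a)) F
  rw [poisson_eq_br, toCotangent_coord, h, mul_one, hF.tw, map_smul, smul_smul]
  change (sgn (coordParity a) * sgn (coordParity (posIdx a) * f)) • _ = _
  rw [coordParity_posIdx]
  rfl

/-- A function cubic in the momenta is determined by its iterated brackets with coordinates. -/
theorem eq_zero_of_poisson_coord_eq_zero {f : ZMod 2} {F : SuperFun (cotangent V) (κ ⊕ κ)}
    (hf : (canonicalData V κ).Hom f F) (hF : euler V κ F = (3 : ℝ) • F)
    (h : ∀ a b c, poisson (poisson (poisson F (toCotangent (coord a))) (toCotangent (coord b)))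
      (toCotangent (coord c)) = 0) : F = 0 := by
  have unsgn : ∀ {a b : ZMod 2} {G : SuperFun (cotangent V) (κ ⊕ κ)},
      (sgn a * sgn b) • G = 0 → G = 0 := fun {a b G} hG => by
    rw [← one_smul ℝ G, ← sgn_mul_self (a + b), sgn_add, ← smul_smul, hG, smul_zero]
  have hc : ∀ a, (canonicalData V κ).Hom (coordParity a) (toCotangent (coord a)) :=
    fun a => HasParity.hom (parityAut_coord a)
  have h1 : ∀ a, euler V κ (poisson F (toCotangent (coord a))) =
      (2 : ℝ) • poisson F (toCotangent (coord a)) := fun a => by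
    rw [euler_poisson hf hF (euler_toCotangent _)]
    norm_num
  have hom1 : ∀ a, (canonicalData V κ).Hom (f + coordParity a)
      (poisson F (toCotangent (coord a))) := fun a => by
    rw [poisson_eq_br]
    exact hf.br (hc a)
  have h2 : ∀ a b, euler V κ (poisson (poisson F (toCotangent (coord a))) (toCotangent (coord b))) =
      (1 : ℝ) • poisson (poisson F (toCotangent (coord a))) (toCotangent (coord b)) :=
    fun a b => by
      rw [euler_poisson (hom1 a) (h1 a) (euler_toCotangent _)]
      norm_num
  have hom2 : ∀ a b, (canonicalData V κ).Hom (f + coordParity a + coordParity b)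
      (poisson (poisson F (toCotangent (coord a))) (toCotangent (coord b))) := fun a b => by
    rw [poisson_eq_br]
    exact (hom1 a).br (hc b)
  -- Successive brackets with coordinates have degrees 2, 1, 0. Euler's formula is applied upwards,
  -- in the nonzero degrees 1, 2 and finally 3.
  have z2 : ∀ a b, poisson (poisson F (toCotangent (coord a))) (toCotangent (coord b)) = 0 :=
    fun a b => eq_zero_of_pderiv_momIdx_eq_zero one_ne_zero (h2 a b) fun c =>
      unsgn ((poisson_coord (hom2 a b) c).symm.trans (h a b c))
  have z1 : ∀ a, poisson F (toCotangent (coord a)) = 0 :=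
    fun a => eq_zero_of_pderiv_momIdx_eq_zero two_ne_zero (h1 a) fun c =>
      unsgn ((poisson_coord (hom1 a) c).symm.trans (z2 a c))
  exact eq_zero_of_pderiv_momIdx_eq_zero three_ne_zero hF fun c =>
      unsgn ((poisson_coord hf c).symm.trans (z1 c))

end

theorem poisson_toCotangent_toCotangent [Fintype κ] (F G : SuperFun V κ) :
    poisson (toCotangent F) (toCotangent G) = 0 := by
  rw [poisson_eq_br]
  refine br_eq_zero fun j => ?_
  rcases j with a | a
  · exact Or.inl (pderiv_momIdx_toCotangent a F)
  · exact Or.inr (pderiv_momIdx_toCotangent a G)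

end Cotangent

/-! ### Functions on the extended manifold -/

/-- Nonzero eigenvectors for distinct eigenvalues are linearly independent, so the nonzero terms of
a vanishing sum cannot exist. It is used for the operator t ∂/∂t, whose eigenvalues are the weights.
-/
theorem eq_zero_of_sum_eigenvectors_eq_zero {M : Type*} [AddCommGroup M] [Module ℝ M]
    (f : Module.End ℝ M) (v : ℝ → M) (hv : ∀ w, f (v w) = w • v w) {s : Finset ℝ}
    (h : ∑ w ∈ s, v w = 0) (w : ℝ) (hw : w ∈ s) : v w = 0 := by
  classical
  by_contra hne
  have hli := f.eigenvectors_linearIndependent' (fun w : s.filter (v · ≠ 0) => w.1)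
    Subtype.val_injective (fun w => v w.1)
    fun w => ⟨Module.End.mem_eigenspace_iff.mpr (hv w.1), (Finset.mem_filter.mp w.2).2⟩
  refine one_ne_zero (Fintype.linearIndependent_iff.mp hli (fun _ => 1) ?_
    ⟨w, Finset.mem_filter.mpr ⟨hw, hne⟩⟩)
  simp only [one_smul]
  rw [Finset.sum_coe_sort (s.filter (v · ≠ 0)) v, Finset.sum_filter_ne_zero, h]

section ExtendedIndex

variable {ι κ : Type}

/-- The index of a coordinate of the superdomain as a coordinate of the extended manifold. -/
def baseIdx : ι ⊕ κ → (ι ⊕ Unit) ⊕ κ := Sum.map Sum.inl id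

/-- The index of the coordinate `t` of the extended manifold. -/
def tIdx : (ι ⊕ Unit) ⊕ κ := Sum.inl (Sum.inr ())

theorem eq_baseIdx_or_eq_tIdx (j : (ι ⊕ Unit) ⊕ κ) : (∃ a, j = baseIdx a) ∨ j = tIdx := by
  rcases j with (i | i) | k
  · exact Or.inl ⟨Sum.inl i, rfl⟩
  · exact Or.inr rfl
  · exact Or.inl ⟨Sum.inr k, rfl⟩

theorem baseIdx_ne_tIdx (a : ι ⊕ κ) : baseIdx a ≠ tIdx := by
  rcases a with a | a <;> simp [baseIdx, tIdx]

theorem coordParity_baseIdx (a : ι ⊕ κ) : coordParity (baseIdx a) = coordParity a := by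
  rcases a with a | a <;> rfl

theorem coordParity_tIdx : coordParity (tIdx : (ι ⊕ Unit) ⊕ κ) = 0 := rfl

end ExtendedIndex

section Extended

variable {ι κ : Type} [Fintype ι] {V : Opens (ι → ℝ)}

theorem toExtended_injective :
    Function.Injective (toExtended : SuperFun V κ → SuperFun (extended V) κ) :=
  pullback_injective _ (fun x hx => ⟨Sum.elim x 1, ⟨hx, one_pos⟩, rfl⟩) Function.injective_id

theorem parityAut_toExtended (F : SuperFun V κ) :
    parityAut (toExtended F) = toExtended (parityAut F) :=
  parityAut_pullback _ _ _ F

theorem toExtended_coord (a : ι ⊕ κ) :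
    toExtended (coord a : SuperFun V κ) = coord (baseIdx a) := pullback_coord _ _ _ a

/-! #### Powers of `t` -/

theorem parityAut_tPow (w : ℝ) : parityAut (tPow w : SuperFun (extended V) κ) = tPow w := by
  rw [tPow, parityAut_tmul, map_one]

theorem restrictSmooth_mul {ι : Type} [Fintype ι] {V : Opens (ι → ℝ)} {F G H : (ι → ℝ) → ℝ}
    (hF : ContDiffOn ℝ ∞ F V) (hG : ContDiffOn ℝ ∞ G V) (hH : ContDiffOn ℝ ∞ H V)
    (h : ∀ x ∈ V, F x * G x = H x) :
    restrictSmooth F hF * restrictSmooth G hG = restrictSmooth H hH := by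
  ext x
  exact h x x.2

theorem tPow_mul_tPow (v w : ℝ) :
    (tPow v * tPow w : SuperFun (extended V) κ) = tPow (v + w) := by
  rw [tPow, tPow, tPow, Algebra.TensorProduct.tmul_mul_tmul, mul_one]
  congr 1
  exact restrictSmooth_mul _ _ _ fun x hx => (Real.rpow_add hx.2 v w).symm

theorem tPow_zero : (tPow 0 : SuperFun (extended V) κ) = 1 := by
  rw [tPow, Algebra.TensorProduct.one_def]
  congr 1
  ext x
  exact Real.rpow_zero _

theorem tPow_one : (tPow 1 : SuperFun (extended V) κ) = coord tIdx := by
  rw [tPow, tIdx, coord_inl]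
  congr 1
  ext x
  exact Real.rpow_one _

variable [DecidableEq ι]

theorem pderiv_toExtended_of_tIdx (F : SuperFun V κ) : pderiv tIdx (toExtended F) = 0 :=
  pderiv_pullback_of_notMem _ _ (fun a => baseIdx_ne_tIdx a) F

theorem pderivSmooth_rpow (i : ι ⊕ Unit) (w : ℝ) (h h') :
    pderivSmooth i (restrictSmooth (V := extended V) (fun z => z (Sum.inr ()) ^ w) h) =
      (if i = Sum.inr () then w else 0) •
        restrictSmooth (fun z => z (Sum.inr ()) ^ (w - 1)) h' := by
  ext x
  rw [pderivSmooth_apply_of_eqOn i _ (F := fun z => z (Sum.inr ()) ^ w) (fun _ => rfl) x]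
  have hd : HasFDerivAt (fun z : ι ⊕ Unit → ℝ => z (Sum.inr ()) ^ w) _ (x : ι ⊕ Unit → ℝ) :=
    (hasFDerivAt_apply (𝕜 := ℝ) (Sum.inr ()) (x : ι ⊕ Unit → ℝ)).rpow_const
      (p := w) (Or.inl x.2.2.ne')
  rw [hd.fderiv]
  change (w * x.1 (Sum.inr ()) ^ (w - 1)) * (Pi.single i 1 : ι ⊕ Unit → ℝ) (Sum.inr ()) =
    (if i = Sum.inr () then w else 0) * x.1 (Sum.inr ()) ^ (w - 1)
  rw [Pi.single_apply]
  by_cases hi : i = Sum.inr ()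
  · rw [if_pos hi, if_pos hi.symm, mul_one]
  · rw [if_neg hi, if_neg (Ne.symm hi), mul_zero, zero_mul]

theorem pderiv_tIdx_tPow (w : ℝ) :
    pderiv tIdx (tPow w : SuperFun (extended V) κ) = w • tPow (w - 1) := by
  rw [tPow, tPow, tIdx, pderiv_inl_tmul, pderivSmooth_rpow, if_pos rfl, TensorProduct.smul_tmul']

theorem pderiv_baseIdx_tPow (a : ι ⊕ κ) (w : ℝ) :
    pderiv (baseIdx a) (tPow w : SuperFun (extended V) κ) = 0 := by
  rcases a with a | a
  · change pderiv (Sum.inl (Sum.inl a)) _ = _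
    rw [tPow, pderiv_inl_tmul, pderivSmooth_rpow _ w _ ((contDiff_apply ℝ ℝ
      (Sum.inr ())).contDiffOn.rpow_const_of_ne fun _ hz => (ne_of_gt hz.2)),
      if_neg Sum.inl_ne_inr, zero_smul, TensorProduct.zero_tmul]
  · change pderiv (Sum.inr a) _ = _
    rw [tPow, pderiv_inr_tmul, CliffordAlgebra.contractLeft_one, TensorProduct.tmul_zero]

/-! #### Generating functions of densities -/

/-- The generating function as a linear map. -/
def genFunₗ : Density V κ →ₗ[ℝ] SuperFun (extended V) κ :=
  Finsupp.lsum ℝ (fun w => LinearMap.mulRight ℝ (tPow w) ∘ₗ toExtended.toLinearMap) ∘ₗ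
    (AddMonoidAlgebra.coeffLinearEquiv ℝ).toLinearMap

omit [DecidableEq ι] in
theorem genFunₗ_apply (ψ : Density V κ) : genFunₗ ψ = genFun ψ := rfl

theorem t_mul_pderiv_tIdx (F : SuperFun V κ) (w : ℝ) :
    coord tIdx * pderiv tIdx (toExtended F * tPow w) = w • (toExtended F * tPow w) := by
  rw [pderiv_mul, pderiv_toExtended_of_tIdx, zero_mul, zero_add, coordParity_tIdx, parityTwist,
    if_pos rfl, pderiv_tIdx_tPow, mul_smul_comm, mul_smul_comm, ← tPow_one]
  have hc : (tPow 1 : SuperFun (extended V) κ) * toExtended F = toExtended F * tPow 1 := by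
    have h := two_smul_mul_comm (toExtended F) (tPow 1)
    rw [parityAut_tPow, sub_self, mul_zero, add_zero, ← two_smul ℝ (tPow 1), mul_smul_comm] at h
    exact smul_right_injective _ (two_ne_zero (α := ℝ)) h
  rw [← mul_assoc, hc, mul_assoc, tPow_mul_tPow, add_sub_cancel]

/-- The components of different weights are separated as eigenvectors of t ∂/∂t, and each
coefficient is then recovered by multiplying with the inverse t^(-w) of t^w. -/
theorem genFun_injective :
    Function.Injective (genFun : Density V κ → SuperFun (extended V) κ) := by
  have key : ∀ ψ : Density V κ, genFunₗ ψ = 0 → ψ = 0 := fun ψ hψ => by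
    refine AddMonoidAlgebra.coeff_eq_zero.mp (Finsupp.ext fun w => ?_)
    by_cases hw : w ∈ ψ.coeff.support
    · let f : Module.End ℝ (SuperFun (extended V) κ) :=
        LinearMap.mulLeft ℝ (coord tIdx) ∘ₗ pderiv tIdx
      let v : ℝ → SuperFun (extended V) κ := fun w => toExtended (ψ.coeff w) * tPow w
      have hv : ∀ w, f (v w) = w • v w := fun w => t_mul_pderiv_tIdx (ψ.coeff w) w
      have hs : ∑ w ∈ ψ.coeff.support, v w = 0 := hψ
      have h : v w = 0 := eq_zero_of_sum_eigenvectors_eq_zero f v hv hs w hw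
      have h2 : toExtended (ψ.coeff w) * tPow w * tPow (-w) = 0 * tPow (-w) :=
        congrArg (· * tPow (-w)) h
      simp only [mul_assoc, tPow_mul_tPow, add_neg_cancel, tPow_zero, mul_one, zero_mul] at h2
      exact toExtended_injective (h2.trans (map_zero _).symm)
    · exact Finsupp.notMem_support_iff.mp hw
  intro ψ χ h
  exact sub_eq_zero.mp (key _ (by
    rw [map_sub, genFunₗ_apply, genFunₗ_apply, h, sub_self]))

omit [DecidableEq ι]

theorem genFun_single (w : ℝ) (F : SuperFun V κ) :
    genFun (AddMonoidAlgebra.single w F : Density V κ) = toExtended F * tPow w := by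
  rw [genFun, AddMonoidAlgebra.coeff_single, Finsupp.sum_single_index]
  rw [map_zero, zero_mul]

theorem DensityHasParity.genFun {ε : ZMod 2} {ψ : Density V κ} (h : DensityHasParity ε ψ) :
    HasParity ε (genFun ψ) := by
  unfold HasParity
  rw [SuperDensity.genFun, Finsupp.sum, map_sum, Finset.smul_sum]
  refine Finset.sum_congr rfl fun w _ => ?_
  rw [map_mul, parityAut_toExtended, parityAut_tPow, h w, map_smul, smul_mul_assoc]

/-- The density whose generating function is a given coordinate of the extended manifold. -/
def coordDensity : (ι ⊕ Unit) ⊕ κ → Density V κ :=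
  Sum.elim
    (Sum.elim (fun i => AddMonoidAlgebra.single 0 (coord (Sum.inl i)))
      (fun _ => AddMonoidAlgebra.single 1 1))
    (fun k => AddMonoidAlgebra.single 0 (coord (Sum.inr k)))

theorem genFun_coordDensity (j : (ι ⊕ Unit) ⊕ κ) :
    genFun (coordDensity j : Density V κ) = coord j := by
  rcases j with (i | i) | k
  · exact (genFun_single _ _).trans (by rw [tPow_zero, mul_one, toExtended_coord]; rfl)
  · exact (genFun_single _ _).trans (by rw [tPow_one, map_one, one_mul]; rfl)
  · exact (genFun_single _ _).trans (by rw [tPow_zero, mul_one, toExtended_coord]; rfl)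

theorem densityHasParity_single {ε : ZMod 2} {F : SuperFun V κ} (h : HasParity ε F) (w : ℝ) :
    DensityHasParity ε (AddMonoidAlgebra.single w F : Density V κ) := fun v => by
  classical
  rw [AddMonoidAlgebra.coeff_single, Finsupp.single_apply]
  split_ifs
  · exact h
  · unfold HasParity
    rw [map_zero, smul_zero]

theorem densityHasParity_coordDensity (j : (ι ⊕ Unit) ⊕ κ) :
    DensityHasParity (coordParity j) (coordDensity j : Density V κ) := by
  rcases j with (i | i) | k
  · exact densityHasParity_single (parityAut_coord (Sum.inl i)) _
  · refine densityHasParity_single ?_ _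
    change parityAut 1 = sgn 0 • (1 : SuperFun V κ)
    rw [map_one, sgn_zero, one_smul]
  · exact densityHasParity_single (parityAut_coord (Sum.inr k)) _

end Extended

/-! ### The master Hamiltonian -/

section MasterIndex

variable {ι κ : Type}

theorem map_posIdx (a : ι ⊕ κ) :
    Sum.map (Sum.map Sum.inl Sum.inl) id (posIdx a) = posIdx (baseIdx a) := by
  rcases a with a | a <;> rfl

theorem map_momIdx (a : ι ⊕ κ) :
    Sum.map (Sum.map Sum.inl Sum.inl) id (momIdx a) = momIdx (baseIdx a) := by
  rcases a with a | a <;> rfl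

end MasterIndex

section Master

variable {ι : Type} [Fintype ι] {V : Opens (ι → ℝ)} {κ : Type}

/-- Functions on the cotangent bundle of the superdomain considered as functions on the cotangent
bundle of the extended manifold. -/
def cotangentToExtended :
    SuperFun (cotangent V) (κ ⊕ κ) →ₐ[ℝ] SuperFun (cotangent (extended V)) (κ ⊕ κ) :=
  pullback (Sum.map Sum.inl Sum.inl) (fun _ hz => hz.1) id

theorem cotangentToExtended_toCotangent (F : SuperFun V κ) :
    cotangentToExtended (toCotangent F) = toCotangent (toExtended F) :=
  pullback_pullback_comm (V := V) (W := cotangent V) (W' := extended V)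
    (U := cotangent (extended V))
    (e := Sum.inl) (o := Sum.inl) (e' := Sum.map Sum.inl Sum.inl) (o' := id)
    (d := Sum.inl) (p := id) (d' := Sum.inl) (p' := Sum.inl)
    (h := fun _ hz => hz) (h' := fun _ hz => hz.1)
    (k := fun _ hz => hz.1) (k' := fun _ hz => hz) rfl rfl F

theorem cotangentToExtended_momentum (a : ι ⊕ κ) :
    cotangentToExtended (momentum a : SuperFun (cotangent V) (κ ⊕ κ)) = momentum (baseIdx a) :=
  (pullback_coord _ _ _ (momIdx a)).trans (by rw [map_momIdx]; rfl)

theorem cotangentToExtended_injective :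
    Function.Injective (cotangentToExtended (V := V) (κ := κ)) := by
  refine pullback_injective _ (fun x hx => ?_) Function.injective_id
  refine ⟨Sum.elim (Sum.elim (x ∘ Sum.inl) 1) (Sum.elim (x ∘ Sum.inr) 0), ⟨hx, one_pos⟩, ?_⟩
  ext (i | i) <;> rfl

variable [DecidableEq ι]

theorem cotangentToExtended_hom {ε : ZMod 2} {F : SuperFun (cotangent V) (κ ⊕ κ)}
    (h : (canonicalData V κ).Hom ε F) :
    (canonicalData (extended V) κ).Hom ε (cotangentToExtended F) := by
  refine (parityAut_pullback _ _ _ F).trans ?_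
  rw [show parityAut F = _ from h, map_smul]
  rfl

theorem pderiv_posIdx_cotangentToExtended (a : ι ⊕ κ) (F : SuperFun (cotangent V) (κ ⊕ κ)) :
    pderiv (posIdx (baseIdx a)) (cotangentToExtended F) =
      cotangentToExtended (pderiv (posIdx a) F) := by
  rw [← map_posIdx]
  exact pderiv_pullback_of_mem (Sum.map_injective.mpr ⟨Sum.inl_injective, Sum.inl_injective⟩) _
    Function.injective_id _ F

theorem pderiv_momIdx_cotangentToExtended (a : ι ⊕ κ) (F : SuperFun (cotangent V) (κ ⊕ κ)) :
    pderiv (momIdx (baseIdx a)) (cotangentToExtended F) =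
      cotangentToExtended (pderiv (momIdx a) F) := by
  rw [← map_momIdx]
  exact pderiv_pullback_of_mem (Sum.map_injective.mpr ⟨Sum.inl_injective, Sum.inl_injective⟩) _
    Function.injective_id _ F

theorem pderiv_posIdx_tIdx_cotangentToExtended (F : SuperFun (cotangent V) (κ ⊕ κ)) :
    pderiv (posIdx tIdx) (cotangentToExtended F) = 0 := by
  refine pderiv_pullback_of_notMem _ _ ?_ F
  rintro ((a | a) | (a | a)) h <;> simp [posIdx, tIdx] at h

theorem pderiv_momIdx_tIdx_cotangentToExtended (F : SuperFun (cotangent V) (κ ⊕ κ)) :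
    pderiv (momIdx tIdx) (cotangentToExtended F) = 0 := by
  refine pderiv_pullback_of_notMem _ _ ?_ F
  rintro ((a | a) | (a | a)) h <;> simp [momIdx, tIdx] at h

variable [Fintype κ]

/-- The bracket on the larger cotangent bundle has one additional conjugate pair (t, p_t), and
functions pulled back from T*M depend on neither. -/
theorem poisson_cotangentToExtended (F G : SuperFun (cotangent V) (κ ⊕ κ)) :
    poisson (cotangentToExtended F) (cotangentToExtended G) =
      cotangentToExtended (poisson F G) := by
  have ht : ∀ ε : ZMod 2, parityTwist ε (cotangentToExtended F) =
      cotangentToExtended (parityTwist ε F) := fun ε => by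
    unfold parityTwist
    split_ifs
    · rfl
    · exact parityAut_pullback _ _ _ F
  unfold poisson
  simp only [ht]
  rw [map_sum, Fintype.sum_sum_type, Fintype.sum_sum_type, Fintype.sum_sum_type]
  have hu : ∑ x : Unit, (sgn (coordParity (Sum.inl (Sum.inr x) : (ι ⊕ Unit) ⊕ κ)) •
      (pderiv (momIdx (Sum.inl (Sum.inr x))) (cotangentToExtended (parityTwist
        (coordParity (Sum.inl (Sum.inr x) : (ι ⊕ Unit) ⊕ κ)) F)) *
          pderiv (posIdx (Sum.inl (Sum.inr x))) (cotangentToExtended G)) -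
      pderiv (posIdx (Sum.inl (Sum.inr x))) (cotangentToExtended (parityTwist
        (coordParity (Sum.inl (Sum.inr x) : (ι ⊕ Unit) ⊕ κ)) F)) *
          pderiv (momIdx (Sum.inl (Sum.inr x))) (cotangentToExtended G)) = 0 := by
    refine Finset.sum_eq_zero fun x _ => ?_
    have h1 := pderiv_posIdx_tIdx_cotangentToExtended G
    have h2 := pderiv_momIdx_tIdx_cotangentToExtended G
    unfold tIdx at h1 h2
    rw [h1, h2, mul_zero, mul_zero, smul_zero, sub_zero]
  rw [hu, add_zero]
  have hb : ∀ a : ι ⊕ κ, sgn (coordParity (baseIdx a)) •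
      (pderiv (momIdx (baseIdx a)) (cotangentToExtended (parityTwist (coordParity (baseIdx a)) F)) *
        pderiv (posIdx (baseIdx a)) (cotangentToExtended G)) -
      pderiv (posIdx (baseIdx a)) (cotangentToExtended (parityTwist (coordParity (baseIdx a)) F)) *
        pderiv (momIdx (baseIdx a)) (cotangentToExtended G) =
      cotangentToExtended (sgn (coordParity a) •
        (pderiv (momIdx a) (parityTwist (coordParity a) F) * pderiv (posIdx a) G) -
        pderiv (posIdx a) (parityTwist (coordParity a) F) * pderiv (momIdx a) G) := fun a => by
    rw [coordParity_baseIdx, pderiv_momIdx_cotangentToExtended, pderiv_posIdx_cotangentToExtended,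
      pderiv_momIdx_cotangentToExtended, pderiv_posIdx_cotangentToExtended, map_sub, map_smul,
      map_mul, map_mul]
  exact congrArg₂ (· + ·) (Finset.sum_congr rfl fun a _ => hb (Sum.inl a))
    (Finset.sum_congr rfl fun a _ => hb (Sum.inr a))

/-- F involves only t and p_t, while the pulled-back function involves neither, so one factor
vanishes in every summand. -/
theorem br_cotangentToExtended_eq_zero {F : SuperFun (cotangent (extended V)) (κ ⊕ κ)}
    (h1 : ∀ a : ι ⊕ κ, pderiv (posIdx (baseIdx a)) F = 0)
    (h2 : ∀ a : ι ⊕ κ, pderiv (momIdx (baseIdx a)) F = 0) (G : SuperFun (cotangent V) (κ ⊕ κ)) :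
    (canonicalData (extended V) κ).br F (cotangentToExtended G) = 0 := by
  refine br_eq_zero fun j => ?_
  rcases j with j | j <;> rcases eq_baseIdx_or_eq_tIdx j with ⟨a, rfl⟩ | rfl
  · exact Or.inl (h2 a)
  · exact Or.inr (pderiv_posIdx_tIdx_cotangentToExtended G)
  · exact Or.inl (h1 a)
  · exact Or.inr (pderiv_momIdx_tIdx_cotangentToExtended G)

variable (V κ) in
/-- The function `t^w` on the cotangent bundle of the extended manifold. -/
abbrev tPowCot (w : ℝ) : SuperFun (cotangent (extended V)) (κ ⊕ κ) := toCotangent (tPow w)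

variable (V κ) in
/-- The momentum `p_t`. -/
abbrev tMomentum : SuperFun (cotangent (extended V)) (κ ⊕ κ) := momentum tIdx

variable (V κ) in
/-- The function `t p_t`. -/
abbrev tTMomentum : SuperFun (cotangent (extended V)) (κ ⊕ κ) := tPowCot V κ 1 * tMomentum V κ

omit [Fintype κ]

theorem tPowCot_hom (w : ℝ) : (canonicalData (extended V) κ).Hom 0 (tPowCot V κ w) := by
  refine HasParity.hom ?_
  unfold HasParity
  rw [parityAut_tPow, sgn_zero, one_smul]

theorem tMomentum_hom : (canonicalData (extended V) κ).Hom 0 (tMomentum V κ) := by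
  have h := momentum_hom (V := extended V) (κ := κ) tIdx
  rwa [coordParity_tIdx] at h

theorem tTMomentum_hom : (canonicalData (extended V) κ).Hom 0 (tTMomentum V κ) := by
  have h := (tPowCot_hom (V := V) (κ := κ) 1).mul tMomentum_hom
  rwa [add_zero] at h

omit [DecidableEq ι] in
theorem tPowCot_mul_tPowCot (v w : ℝ) : tPowCot V κ v * tPowCot V κ w = tPowCot V κ (v + w) := by
  rw [tPowCot, tPowCot, ← map_mul, tPow_mul_tPow]

theorem pderiv_posIdx_baseIdx_tPowCot (a : ι ⊕ κ) (w : ℝ) :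
    pderiv (posIdx (baseIdx a)) (tPowCot V κ w) = 0 := by
  rw [pderiv_posIdx_toCotangent, pderiv_baseIdx_tPow, map_zero]

theorem pderiv_even_mul {j : ι ⊕ κ} (hj : coordParity j = 0) (F G : SuperFun V κ) :
    pderiv j (F * G) = pderiv j F * G + F * pderiv j G := by
  rw [pderiv_mul, hj, parityTwist, if_pos rfl]

theorem pderiv_tPowCot_mul_tMomentum [DecidableEq κ] (a : ι ⊕ κ) :
    pderiv (posIdx (baseIdx a)) (tTMomentum V κ) = 0 ∧
      pderiv (momIdx (baseIdx a)) (tTMomentum V κ) = 0 := by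
  have h := fun j => (tPowCot_hom (V := V) (κ := κ) 1).D_mul j (tMomentum V κ)
  have p1 : (canonicalData (extended V) κ).D (Sum.inl (baseIdx a)) (tMomentum V κ) = 0 :=
    (D_coord (Sum.inr tIdx) (Sum.inl (baseIdx a))).trans (if_neg Sum.inr_ne_inl)
  have p2 : (canonicalData (extended V) κ).D (Sum.inr (baseIdx a)) (tMomentum V κ) = 0 :=
    (D_coord (Sum.inr tIdx) (Sum.inr (baseIdx a))).trans
      (if_neg fun h => baseIdx_ne_tIdx a (Sum.inr.inj h).symm)
  have q1 : (canonicalData (extended V) κ).D (Sum.inl (baseIdx a)) (tPowCot V κ 1) = 0 :=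
    pderiv_posIdx_baseIdx_tPowCot a 1
  have q2 : (canonicalData (extended V) κ).D (Sum.inr (baseIdx a)) (tPowCot V κ 1) = 0 :=
    pderiv_momIdx_toCotangent _ _
  refine ⟨(h (Sum.inl (baseIdx a))).trans ?_, (h (Sum.inr (baseIdx a))).trans ?_⟩
  · simp only [p1, q1, zero_mul, mul_zero, smul_zero, add_zero]
  · simp only [p2, q2, zero_mul, mul_zero, smul_zero, add_zero]

variable [Fintype κ] [DecidableEq κ]

/-- On functions of t the Hamiltonian t p_t generates the dilation t ∂/∂t. This is the only source
of λ in the component equations. -/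
theorem br_tTMomentum_tPowCot (w : ℝ) :
    (canonicalData (extended V) κ).br (tTMomentum V κ) (tPowCot V κ w) = w • tPowCot V κ w := by
  have hz : (canonicalData (extended V) κ).br (tPowCot V κ 1) (tPowCot V κ w) = 0 := by
    rw [← poisson_eq_br, poisson_toCotangent_toCotangent]
  -- With p_t in the second slot a single summand survives, since a coordinate has just one nonzero
  -- derivative. Antisymmetry restores the order afterwards.
  have hp : (canonicalData (extended V) κ).br (tPowCot V κ w) (tMomentum V κ) =
      -(w • tPowCot V κ (w - 1)) := by
    have h := br_of_D_eq_ite (R := canonicalData (extended V) κ) (i := Sum.inr tIdx)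
      (G := tMomentum V κ) (K := 1) (D_coord (Sum.inr tIdx)) (tPowCot V κ w)
    rw [h, mul_one, (tPowCot_hom w).tw, mul_zero, sgn_zero, one_smul]
    change (-1 : ℝ) • pderiv (posIdx tIdx) (tPowCot V κ w) = _
    rw [pderiv_posIdx_toCotangent, pderiv_tIdx_tPow, map_smul, neg_one_smul]
  rw [(tPowCot_hom 1).br_mul_left tMomentum_hom (tPowCot_hom w), hz,
    (tPowCot_hom w).br_antisymm tMomentum_hom, hp]
  simp only [mul_zero, sgn_zero, one_smul, neg_neg, zero_mul, add_zero, mul_smul_comm,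
    tPowCot_mul_tPowCot, add_sub_cancel]

end Master

/-! ### Components of the master Hamiltonian and the two equivalences -/

section Coeffs

variable {ι : Type} [Fintype ι] {V : Opens (ι → ℝ)} {κ : Type} [Fintype κ]

namespace BracketCoeffs

variable {ε : ZMod 2} (C : BracketCoeffs V κ ε)

theorem cotangentToExtended_hamS : cotangentToExtended C.hamS =
    (1 / 2 : ℝ) • ∑ a, ∑ b, toCotangent (toExtended (C.S a b)) * momentum (baseIdx b) *
      momentum (baseIdx a) := by
  simp only [hamS, map_smul, map_sum, map_mul, cotangentToExtended_toCotangent,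
    cotangentToExtended_momentum]

theorem cotangentToExtended_hamγ : cotangentToExtended C.hamγ =
    ∑ a, toCotangent (toExtended (C.γ a)) * momentum (baseIdx a) := by
  simp only [hamγ, map_sum, map_mul, cotangentToExtended_toCotangent,
    cotangentToExtended_momentum]

omit [Fintype κ] in
theorem cotangentToExtended_hamθ : cotangentToExtended C.hamθ =
    toCotangent (toExtended C.θ) := cotangentToExtended_toCotangent _

variable [DecidableEq ι]

theorem hamS_hom : (canonicalData V κ).Hom ε C.hamS := by
  refine Hom.smul _ (Hom.sum fun a _ => Hom.sum fun b _ => ?_)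
  have h := ((HasParity.hom (C.parity_S a b)).mul (momentum_hom b)).mul (momentum_hom a)
  have e : ε + coordParity a + coordParity b + coordParity b + coordParity a = ε :=
    (by decide : ∀ e a b : ZMod 2, e + a + b + b + a = e) _ _ _
  rwa [e] at h

theorem hamγ_hom : (canonicalData V κ).Hom ε C.hamγ := by
  refine Hom.sum fun a _ => ?_
  have h := (HasParity.hom (C.parity_γ a)).mul (momentum_hom a)
  have e : ε + coordParity a + coordParity a = ε :=
    (by decide : ∀ e a : ZMod 2, e + a + a = e) _ _
  rwa [e] at h

omit [Fintype κ] in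
theorem hamθ_hom : (canonicalData V κ).Hom ε C.hamθ := HasParity.hom C.parity_θ

theorem sq_mul_mul_sq {A : Type*} [Ring A] {t p : A} (hp : ∀ x, p * x = x * p) (x : A) :
    t ^ 2 * x * p ^ 2 = t * p * (t * p * x) := by
  rw [mul_assoc t p, hp (t * p * x), mul_assoc t p x, hp x]
  noncomm_ring

/-- The master Hamiltonian as `t^lam (S + t p_t γ + ½ (t p_t)² θ)`. -/
theorem master_eq (lam : ℝ) : C.master lam = tPowCot V κ lam * (cotangentToExtended C.hamS +
    tTMomentum V κ * cotangentToExtended C.hamγ +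
    (1 / 2 : ℝ) • (tTMomentum V κ * (tTMomentum V κ * cotangentToExtended C.hamθ))) := by
  have hp : ∀ x, tMomentum V κ * x = x * tMomentum V κ := tMomentum_hom.commute
  have ht : toCotangent (coord (Sum.inl (Sum.inr ()))) = tPowCot V κ 1 := by
    rw [tPowCot, tPow_one]
    rfl
  have hγ : ∑ a, tPowCot V κ 1 * toCotangent (toExtended (C.γ a)) * momentum (baseIdx a) *
      tMomentum V κ = tTMomentum V κ * cotangentToExtended C.hamγ := by
    rw [cotangentToExtended_hamγ, Finset.mul_sum]
    refine Finset.sum_congr rfl fun a _ => ?_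
    rw [tTMomentum, mul_assoc (tPowCot V κ 1) (tMomentum V κ), hp, mul_assoc, mul_assoc, mul_assoc]
  have hθ : tPowCot V κ 1 ^ 2 * toCotangent (toExtended C.θ) * tMomentum V κ ^ 2 =
      tTMomentum V κ * (tTMomentum V κ * cotangentToExtended C.hamθ) := by
    rw [cotangentToExtended_hamθ]
    exact sq_mul_mul_sq hp _
  have h : C.master lam = (1 / 2 : ℝ) • (tPowCot V κ lam * ((∑ a, ∑ b,
      toCotangent (toExtended (C.S a b)) * momentum (baseIdx b) * momentum (baseIdx a)) +
      (2 : ℝ) • (∑ a, toCotangent (coord (Sum.inl (Sum.inr ()))) *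
        toCotangent (toExtended (C.γ a)) * momentum (baseIdx a) * tMomentum V κ) +
      toCotangent (coord (Sum.inl (Sum.inr ()))) ^ 2 * toCotangent (toExtended C.θ) *
        tMomentum V κ ^ 2)) := rfl
  rw [h, ht, hγ, hθ, cotangentToExtended_hamS, ← mul_smul_comm]
  congr 1
  module

theorem master_hom (lam : ℝ) : (canonicalData (extended V) κ).Hom ε (C.master lam) := by
  have hS := cotangentToExtended_hom C.hamS_hom
  have hγ := tTMomentum_hom.mul (cotangentToExtended_hom C.hamγ_hom)
  have hθ := tTMomentum_hom.mul (tTMomentum_hom.mul (cotangentToExtended_hom C.hamθ_hom))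
  rw [zero_add] at hγ hθ
  rw [zero_add] at hθ
  rw [master_eq]
  have h := (tPowCot_hom (V := V) (κ := κ) lam).mul ((hS.add hγ).add (hθ.smul (1 / 2)))
  rwa [zero_add] at h

/-- S, τγ and τ²θ have momentum degrees 2, 1 + 1 and 2 + 0. By `euler_poisson` the bracket (Ŝ,Ŝ) is
then cubic. -/
theorem euler_master [DecidableEq κ] (lam : ℝ) :
    euler (extended V) κ (C.master lam) = (2 : ℝ) • C.master lam := by
  have hS : euler (extended V) κ (cotangentToExtended C.hamS) =
      (2 : ℝ) • cotangentToExtended C.hamS := by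
    rw [cotangentToExtended_hamS, map_smul, smul_comm]
    congr 1
    simp only [map_sum, Finset.smul_sum]
    refine Finset.sum_congr rfl fun a _ => Finset.sum_congr rfl fun b _ => ?_
    rw [euler_mul (euler_mul (euler_toCotangent _) (euler_momentum _)) (euler_momentum _)]
    norm_num
  have hγ : euler (extended V) κ (cotangentToExtended C.hamγ) =
      (1 : ℝ) • cotangentToExtended C.hamγ := by
    rw [cotangentToExtended_hamγ]
    simp only [map_sum, Finset.smul_sum]
    refine Finset.sum_congr rfl fun a _ => ?_
    rw [euler_mul (euler_toCotangent _) (euler_momentum _), zero_add]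
  have hθ : euler (extended V) κ (cotangentToExtended C.hamθ) =
      (0 : ℝ) • cotangentToExtended C.hamθ := by
    rw [cotangentToExtended_hamθ]
    exact euler_toCotangent _
  have hτ : euler (extended V) κ (tTMomentum V κ) = (1 : ℝ) • tTMomentum V κ := by
    rw [tTMomentum, euler_mul (euler_toCotangent _) (euler_momentum _), zero_add]
  have hτγ := euler_mul hτ hγ
  have hτθ := euler_mul hτ (euler_mul hτ hθ)
  rw [master_eq]
  have h : euler (extended V) κ (cotangentToExtended C.hamS +
      tTMomentum V κ * cotangentToExtended C.hamγ +
      (1 / 2 : ℝ) • (tTMomentum V κ * (tTMomentum V κ * cotangentToExtended C.hamθ))) =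
      (2 : ℝ) • (cotangentToExtended C.hamS + tTMomentum V κ * cotangentToExtended C.hamγ +
        (1 / 2 : ℝ) • (tTMomentum V κ * (tTMomentum V κ * cotangentToExtended C.hamθ))) := by
    rw [map_add, map_add, map_smul, hS, hτγ, hτθ]
    module
  rw [euler_mul (euler_toCotangent (tPow lam)) h, zero_add]

end BracketCoeffs

/-- The classical master equation on the extended manifold is equivalent to the equations for its
components. -/
theorem poisson_master_eq_zero_iff [DecidableEq ι] [DecidableEq κ] (C : BracketCoeffs V κ 1)
    (lam : ℝ) :
    poisson (C.master lam) (C.master lam) = 0 ↔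
      poisson C.hamS C.hamS = (2 * lam) • (C.hamS * C.hamγ) ∧
      poisson C.hamS C.hamγ = lam • (C.hamS * C.hamθ) ∧
      poisson C.hamS C.hamθ + poisson C.hamγ C.hamγ = lam • (C.hamγ * C.hamθ) ∧
      poisson C.hamγ C.hamθ = 0 := by
  have hT : ∀ G : SuperFun (cotangent V) (κ ⊕ κ),
      (canonicalData (extended V) κ).br (tPowCot V κ lam) (cotangentToExtended G) = 0 :=
    br_cotangentToExtended_eq_zero (fun a => pderiv_posIdx_baseIdx_tPowCot a lam)
      (fun a => pderiv_momIdx_toCotangent _ _)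
  have hτ : ∀ G : SuperFun (cotangent V) (κ ⊕ κ),
      (canonicalData (extended V) κ).br (tTMomentum V κ) (cotangentToExtended G) = 0 :=
    br_cotangentToExtended_eq_zero (fun a => (pderiv_tPowCot_mul_tMomentum a).1)
      (fun a => (pderiv_tPowCot_mul_tMomentum a).2)
  have hθθ : (canonicalData (extended V) κ).br (cotangentToExtended C.hamθ)
      (cotangentToExtended C.hamθ) = 0 := by
    rw [C.cotangentToExtended_hamθ, ← poisson_eq_br, poisson_toCotangent_toCotangent]
  have key := br_self_master (tPowCot_hom lam) tTMomentum_hom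
    (cotangentToExtended_hom C.hamS_hom) (cotangentToExtended_hom C.hamγ_hom)
    (cotangentToExtended_hom C.hamθ_hom) (hT _) (hT _) (hT _) (hτ _) (hτ _) (hτ _)
    (br_tTMomentum_tPowCot lam) hθθ
  simp only [← poisson_eq_br, poisson_cotangentToExtended, ← map_mul, ← map_smul, ← map_sub,
    ← map_add] at key
  rw [← C.master_eq] at key
  rw [key]
  -- The prefactor t^λ · t^λ is invertible because t > 0.
  have cancel : ∀ x : SuperFun (cotangent (extended V)) (κ ⊕ κ),
      tPowCot V κ lam * (tPowCot V κ lam * x) = 0 ↔ x = 0 := fun x => by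
    have hinv : tPowCot V κ (-lam) * tPowCot V κ lam = 1 := by
      rw [tPowCot_mul_tPowCot, neg_add_cancel, tPowCot, tPow_zero, map_one]
    have hl : ∀ y : SuperFun (cotangent (extended V)) (κ ⊕ κ),
        tPowCot V κ lam * y = 0 → y = 0 := fun y hy => by
      rw [← one_mul y, ← hinv, mul_assoc, hy, mul_zero]
    exact ⟨fun h => hl _ (hl _ h), fun h => by rw [h, mul_zero, mul_zero]⟩
  rw [cancel]
  have hinj : ∀ F : SuperFun (cotangent V) (κ ⊕ κ), cotangentToExtended F = 0 ↔ F = 0 :=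
    fun F => map_eq_zero_iff _ cotangentToExtended_injective
  constructor
  · intro h
    -- The derivative along p_t annihilates everything pulled back from T*M and sends τ to t, so it
    -- separates the powers of τ.
    have hD : ∀ F G : SuperFun (cotangent (extended V)) (κ ⊕ κ),
        pderiv (momIdx tIdx) (F * G) =
          pderiv (momIdx tIdx) F * G + F * pderiv (momIdx tIdx) G := pderiv_even_mul rfl
    have hτD : pderiv (momIdx tIdx) (tTMomentum V κ) = tPowCot V κ 1 := by
      rw [tTMomentum, hD, tPowCot, pderiv_momIdx_toCotangent, pderiv_momIdx_momentum, if_pos rfl,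
        zero_mul, zero_add, mul_one]
    have hinv : tPowCot V κ (-1) * tPowCot V κ 1 = 1 := by
      rw [tPowCot_mul_tPowCot, neg_add_cancel, tPowCot, tPow_zero, map_one]
    obtain ⟨h0, h1, h2, h3⟩ := eq_zero_of_polynomial_eq_zero hD (tPowCot_hom 1).commute hinv hτD
      (pderiv_momIdx_tIdx_cotangentToExtended _) (pderiv_momIdx_tIdx_cotangentToExtended _)
      (pderiv_momIdx_tIdx_cotangentToExtended _) (pderiv_momIdx_tIdx_cotangentToExtended _) h
    rw [hinj] at h0 h1 h2 h3
    exact ⟨sub_eq_zero.mp h0, sub_eq_zero.mp ((smul_eq_zero.mp h1).resolve_left two_ne_zero),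
      sub_eq_zero.mp h2, h3⟩
  · rintro ⟨h0, h1, h2, h3⟩
    rw [h0, h1, h2, h3]
    simp only [sub_self, smul_zero, map_zero, mul_zero, add_zero]

/-- The Jacobi identity for the bracket specified by a Hamiltonian is equivalent to the classical
master equation. -/
theorem LongBracket.jacobi_iff_poisson_master [DecidableEq ι] [DecidableEq κ] {lam : ℝ}
    (B : LongBracket V κ 1 lam) (C : BracketCoeffs V κ 1) (hB : B.SpecifiedBy (C.master lam)) :
    B.Jacobi ↔ poisson (C.master lam) (C.master lam) = 0 := by
  have hH := C.master_hom lam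
  have key : ∀ (α β δ : ZMod 2) (a b c : Density V κ),
      DensityHasParity α a → DensityHasParity β b → DensityHasParity δ c →
      (2 : ℝ) • toCotangent (genFunₗ (sgn (α * δ) • B.op (B.op a b) c +
        sgn (δ * β) • B.op (B.op c a) b + sgn (β * α) • B.op (B.op b c) a)) =
      sgn (α * δ) • poisson (poisson (poisson (poisson (C.master lam) (C.master lam))
        (toCotangent (genFun a))) (toCotangent (genFun b))) (toCotangent (genFun c)) := by
    intro α β δ a b c ha hb hc
    have h := hH.jacobiator ha.genFun.hom hb.genFun.hom hc.genFun.hom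
    -- By `hB` every derived bracket of base functions is again a base function, the generating
    -- function of a density. This discharges the commutation hypotheses of `Hom.jacobiator`.
    simp only [← poisson_eq_br, ← hB _ _, poisson_toCotangent_toCotangent] at h
    rw [← h trivial trivial trivial]
    simp only [map_add, map_smul, genFunₗ_apply]
  constructor
  · intro hJ
    have hK : (canonicalData (extended V) κ).Hom (1 + 1) (poisson (C.master lam) (C.master lam)) := by
      rw [poisson_eq_br]
      exact hH.br hH
    have h3 := euler_poisson hH (C.euler_master lam) (C.euler_master lam)
    rw [show (2 + 2 - 1 : ℝ) = 3 by norm_num] at h3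
    -- The Jacobi identity is used only on coordinates of the extended manifold: each x^a is a
    -- density of weight 0 and t one of weight 1.
    refine eq_zero_of_poisson_coord_eq_zero hK h3 fun i j k => ?_
    have h := key _ _ _ _ _ _ (densityHasParity_coordDensity i) (densityHasParity_coordDensity j)
      (densityHasParity_coordDensity k)
    rw [hJ _ _ _ _ _ _ (densityHasParity_coordDensity i) (densityHasParity_coordDensity j)
      (densityHasParity_coordDensity k), map_zero, map_zero, smul_zero, genFun_coordDensity,
      genFun_coordDensity, genFun_coordDensity] at h
    have h' := congrArg (sgn (coordParity i * coordParity k) • ·) h.symm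
    simpa only [smul_smul, sgn_mul_self, one_smul, smul_zero] using h'
  · intro h0 α β δ a b c ha hb hc
    have h := key α β δ a b c ha hb hc
    have hz : ∀ G : SuperFun (cotangent (extended V)) (κ ⊕ κ), poisson 0 G = 0 := fun G => by
      rw [poisson_eq_br, map_zero, LinearMap.zero_apply]
    rw [h0, hz, hz, hz, smul_zero] at h
    have h1 := (smul_eq_zero.mp h).resolve_left two_ne_zero
    -- The vanishing descends from the cotangent bundle to the extended manifold, and from there to
    -- densities.
    have h2 := toCotangent_injective (h1.trans (map_zero _).symm)
    exact genFun_injective (h2.trans (map_zero genFunₗ).symm)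

end Coeffs

end SuperDensity

end

open TopologicalSpace SuperDensity
theorem mainTheorem11 {n m : ℕ} (V : Opens (Fin n → ℝ)) (lam : ℝ)
    (B : LongBracket V (Fin m) 1 lam) (C : BracketCoeffs V (Fin m) 1)
    (hB : B.SpecifiedBy (C.master lam)) :
    B.Jacobi ↔
      poisson C.hamS C.hamS = (2 * lam) • (C.hamS * C.hamγ) ∧
      poisson C.hamS C.hamγ = lam • (C.hamS * C.hamθ) ∧
      poisson C.hamS C.hamθ + poisson C.hamγ C.hamγ = lam • (C.hamγ * C.hamθ) ∧
      poisson C.hamγ C.hamθ = 0 :=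
  (B.jacobi_iff_poisson_master C hB).trans (poisson_master_eq_zero_iff C lam)
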